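/- Setting. Let $L,k_0,d\ge 1$ be integers with $k_0<L$, put $N=Ld$ and $k=k_0d$. A signal is $\mathbf x=\mathbf V\mathbf c$ with $\mathbf V\in\mathbb R^{N\times N}$ orthonormal and $\mathbf c=(\mathbf c_0,\dots,\mathbf c_{L-1})$, $\mathbf c_m\in\mathbb R^d$, having exactly $k_0$ nonzero blocks; its block sparsity pattern is $\mathcal U=\{m:\mathbf c_m\neq 0\}$. One observes $\mathbf y=\mathbf A\mathbf V\mathbf c+\mathbf w\in\mathbb R^M$, where $\mathbf A\in\mathbb R^{M\times N}$ is known and has i.i.d. $\mathcal N(0,1)$ entries, and $\mathbf w\sim\mathcal N(\mathbf 0,\sigma_w^2\mathbf I_M)$, $\sigma_w>0$, is independent of $\mathbf A$. The pattern is uniform among the $\binom{L}{k_0}$ sets of $k_0$ block indices, and to each pattern $\mathcal U$ belongs a fixed unknown $\mathbf c$ with that pattern; $\mathrm{BSNR}_{\min}$ is the minimum of $\|\mathbf c_m\|_2^2/\sigma_w^2$ over all patterns $\mathcal U$ and all $m\in\mathcal U$. A maximum likelihood (ML) decoder returns a set $\hat{\mathcal U}$ of $k_0$ block indices for which the likelihood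 of $\mathbf y$, maximized over all coefficient vectors that vanish outside the set, is largest; $P_e$ is the average probability, over $\mathbf A$, $\mathbf w$ and the pattern, that $\hat{\mathcal U}\neq\mathcal U$. The explicit bound associated with $P_e$ is $$\bar P_e=\sum_{l=1}^{k_0}\binom{k_0}{l}\binom{L-k_0}{l}\Big(Q\big(\tfrac12(1-2\eta_0)\sqrt{\lambda_l}\big)+\frac{\sqrt2}{2^l\Gamma(l/2)}(\eta_0\lambda_l)^{\frac{l-1}2}K_{\frac{l-1}2}\big(\tfrac{\eta_0\lambda_l}{2}\big)\Big),\qquad \lambda_l=(M-k)\,l\,\mathrm{BSNR}_{\min},$$ with $Q(x)=\frac1{\sqrt{2\pi}}\int_x^\infty e^{-t^2/2}dt$ and $K_\nu(x)=\int_0^\infty e^{-x\cosh t}\cosh(\nu t)\,dt$. Statement. Let $0<\eta_0<\frac12$ and $r_0>0$ be constants, $b_0=\frac{\sqrt{2\pi}}4$, and consider the condition $$M>k+\max\{\bar M_1,\bar M_2\},\qquad(*)$$ $$\bar M_1=\frac{16}{\mathrm{BSNR}_{\min}(1-2\eta_0)^2}\Big(\log(L-k_0)+\log\frac{e}{\sqrt2}\Big),\qquad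 \bar M_2=\frac{4(k_0/2+r_0-1)}{\eta_0r_0\,\mathrm{BSNR}_{\min}}\Big\{\log(L-k_0)+\frac12\log\frac{2b_0e^2}{\sqrt\pi}\Big\}.$$ (a) For given $L,k_0,d$, both $P_e$ (for every ML decoder) and $\bar P_e$ tend to $0$ as $(M-k)\,\mathrm{BSNR}_{\min}\to\infty$ subject to $(*)$: for each $\varepsilon>0$ there is an $R$, depending only on $\varepsilon,\eta_0,r_0,L,k_0,d$, such that $P_e<\varepsilon$ and $\bar P_e<\varepsilon$ whenever $(M-k)\,\mathrm{BSNR}_{\min}\ge R$ and $(*)$ holds, whatever $M$, $\sigma_w$, $\mathbf V$ and the signals are. (b) The bound $\bar P_e$ tends to $0$ also when $L,k_0,d$ vary along with $M$ and $\mathrm{BSNR}_{\min}$: for each $\varepsilon>0$ there is an $R$, depending only on $\varepsilon,\eta_0,r_0$, such that $\bar P_e<\varepsilon$ for all $L,k_0,d\ge1$, $M$ and $\mathrm{BSNR}_{\min}>0$ with $k_0\le L/2$, with $r_0\ge 1$ in case $k_0=1$, with $(M-k)\,\mathrm{BSNR}_{\min}\ge R$ and with $(*)$. -/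

import Mathlib

namespace BlockRecovery

noncomputable section

/-! ## Special functions and the explicit quantities of the statement -/

/-- The Gaussian tail function `Q(x) = (2π)^{-1/2} ∫_x^∞ exp(-t²/2) dt`. -/
def gaussianQ (x : ℝ) : ℝ :=
  1 / Real.sqrt (2 * Real.pi) * ∫ t in Set.Ioi x, Real.exp (-t ^ 2 / 2)

/-- The modified Bessel function `K_ν(x) = ∫_0^∞ exp(-x cosh t) cosh(ν t) dt` (for `x > 0`). -/
def besselK (ν x : ℝ) : ℝ :=
  ∫ t in Set.Ioi (0 : ℝ), Real.exp (-x * Real.cosh t) * Real.cosh (ν * t)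

/-- `Ψ(l, λ) = √2 / (2^l Γ(l/2)) (η₀ λ)^{l/2-1/2} K_{l/2-1/2}(η₀ λ / 2)`. -/
def Psi (η₀ : ℝ) (l : ℕ) (lam : ℝ) : ℝ :=
  Real.sqrt 2 / (2 ^ l * Real.Gamma ((l : ℝ) / 2)) * (η₀ * lam) ^ ((l : ℝ) / 2 - 1 / 2) *
    besselK ((l : ℝ) / 2 - 1 / 2) (η₀ * lam / 2)

/-- The explicit upper bound on the ML error probability with Gaussian sampling, as a function of
the number `L` of blocks, the block sparsity `k₀`, the block length `d` (so that `k = k₀ d`),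
the number `M` of samples and the minimum block SNR `B`. -/
def errorBound (η₀ : ℝ) (L k₀ d M : ℕ) (B : ℝ) : ℝ :=
  ∑ l ∈ Finset.Icc 1 k₀, (k₀.choose l : ℝ) * ((L - k₀).choose l : ℝ) *
    (gaussianQ (1 / 2 * (1 - 2 * η₀) * Real.sqrt (((M : ℝ) - (k₀ * d : ℕ)) * l * B)) +
      Psi η₀ l (((M : ℝ) - (k₀ * d : ℕ)) * l * B))

/-- `b₀ = √(2π) / 4`. -/
def b₀ : ℝ := Real.sqrt (2 * Real.pi) / 4

/-- The threshold `M̄₁`. -/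
def Mbar₁ (η₀ : ℝ) (L k₀ : ℕ) (B : ℝ) : ℝ :=
  16 / (B * (1 - 2 * η₀) ^ 2) *
    (Real.log ((L : ℝ) - k₀) + Real.log (Real.exp 1 / Real.sqrt 2))

/-- The threshold `M̄₂`. -/
def Mbar₂ (η₀ r₀ : ℝ) (L k₀ : ℕ) (B : ℝ) : ℝ :=
  4 * ((k₀ : ℝ) / 2 + r₀ - 1) / (η₀ * r₀ * B) *
    (Real.log ((L : ℝ) - k₀) +
      1 / 2 * Real.log (2 * b₀ * Real.exp 1 ^ 2 / Real.sqrt Real.pi))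

/-! ## The block sparse observation model -/

/-- Coefficient vectors made of `L` blocks of length `d`; each block carries the Euclidean norm. -/
abbrev BlockVec (L d : ℕ) : Type := Fin L → EuclideanSpace ℝ (Fin d)

/-- The possible block supports: the `k₀`-element sets of block indices. -/
abbrev BlockSupport (L k₀ : ℕ) : Type := {U : Finset (Fin L) // U.card = k₀}

/-- All blocks of `c` outside `U` vanish. -/
def SupportedIn {L d : ℕ} (c : BlockVec L d) (U : Finset (Fin L)) : Prop :=
  ∀ m, m ∉ U → c m = 0

/-- `U` is exactly the set of indices of the nonzero blocks of `c`. -/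
def HasBlockSupport {L d : ℕ} (c : BlockVec L d) (U : Finset (Fin L)) : Prop :=
  ∀ m, m ∈ U ↔ c m ≠ 0

/-- The minimum nonzero block SNR of one signal: `min ‖c_m‖² / σ²` over the nonzero blocks. -/
def blockSNR {L d : ℕ} (σ : ℝ) (c : BlockVec L d) : ℝ :=
  ⨅ m : {m : Fin L // c m ≠ 0}, ‖c m.1‖ ^ 2 / σ ^ 2

/-- The minimum nonzero block SNR over the signals `c U` attached to the possible supports `U`. -/
def bsnrMin {L d k₀ : ℕ} (σ : ℝ) (c : BlockSupport L k₀ → BlockVec L d) : ℝ :=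
  ⨅ U : BlockSupport L k₀, blockSNR σ (c U)

/-- The noiseless samples `A V c`, where `A` is `M × N`, `V` is `N × N`, and `N = L d`; the columns
of `V` are indexed by a block and a position in the block. -/
def samples {L d M : ℕ} (A : Fin M → Fin (L * d) → ℝ)
    (V : Matrix (Fin (L * d)) (Fin L × Fin d) ℝ) (c : BlockVec L d) : Fin M → ℝ :=
  (Matrix.of A * V).mulVec fun p => c p.1 p.2

/-- The density at `y` of the law `N(A V c, σ² I_M)` of the observation given `A` and `c`. -/
def likelihood {L d M : ℕ} (σ : ℝ) (A : Fin M → Fin (L * d) → ℝ)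
    (V : Matrix (Fin (L * d)) (Fin L × Fin d) ℝ) (c : BlockVec L d) (y : Fin M → ℝ) : ℝ :=
  ∏ m, ProbabilityTheory.gaussianPDFReal (samples A V c m) (σ ^ 2).toNNReal (y m)

/-- `ζ` is a maximum likelihood decoder of the block support (the sampling matrix being known and
the coefficients being unknown): the likelihood, maximized over the coefficient vectors supported
in a set `U` of size `k₀`, is largest for `U = ζ A y`. Ties are broken arbitrarily. -/
def IsMLDecoder {L d M k₀ : ℕ} (σ : ℝ) (V : Matrix (Fin (L * d)) (Fin L × Fin d) ℝ)
    (ζ : (Fin M → Fin (L * d) → ℝ) → (Fin M → ℝ) → BlockSupport L k₀) : Prop :=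
  ∀ A y, ∃ chat : BlockVec L d, SupportedIn chat (ζ A y).1 ∧
    ∀ (U : BlockSupport L k₀) (c : BlockVec L d), SupportedIn c U.1 →
      likelihood σ A V c y ≤ likelihood σ A V chat y

/-- The joint law of the sampling matrix (i.i.d. standard Gaussian entries) and of the
independent noise vector with law `N(0, σ² I_M)`. -/
def jointLaw (M N : ℕ) (σ : ℝ) :
    MeasureTheory.Measure ((Fin M → Fin N → ℝ) × (Fin M → ℝ)) :=
  (MeasureTheory.Measure.pi fun _ => MeasureTheory.Measure.pi fun _ =>
      ProbabilityTheory.gaussianReal 0 1).prod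
    (MeasureTheory.Measure.pi fun _ => ProbabilityTheory.gaussianReal 0 (σ ^ 2).toNNReal)

/-- The average probability of error of the decoder `ζ`: the true support `U` is uniform among
the `T = L.choose k₀` possible supports, and the observation given `U` is `y = A V (c U) + w`. -/
def errorProb {L d M k₀ : ℕ} (σ : ℝ) (V : Matrix (Fin (L * d)) (Fin L × Fin d) ℝ)
    (c : BlockSupport L k₀ → BlockVec L d)
    (ζ : (Fin M → Fin (L * d) → ℝ) → (Fin M → ℝ) → BlockSupport L k₀) : ℝ :=
  ∑ U : BlockSupport L k₀, 1 / (L.choose k₀ : ℝ) *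
    (jointLaw M (L * d) σ).real {p | ζ p.1 (samples p.1 V (c U) + p.2) ≠ U}

end

end BlockRecovery

open BlockRecovery

/-! Put `k = k₀ d`, `τ = (M - k) BSNR_min`, `n = L - k₀`.

Decoding error. If the decoder returns a wrong set `U'`, the least squares residual of `y` over the
columns of the blocks in `U'` is at most `‖w‖²`. Let `h` be the part of the true signal outside
`U'`. It contains a whole nonzero block, so `ρ = ‖h‖ / σ` satisfies `ρ² ≥ BSNR_min`. Since `V` is
orthonormal, the columns of `U'` and the direction of `h` become independent Gaussian vectors. A
rotation sends the column space into the last `k` coordinates; in the other `M - k` coordinates the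
signal `ρ g` cannot be compensated. The error thus forces a small chi-squared variable, large noise
in `k` coordinates, or an atypical inner product of signal and noise
(`stdGauss_prod_quadratic_event_le`). With a free threshold `T` this costs `√(eT/τ) + (4k + 16)/T`.
A union bound over the finitely many sets, with `T` fixed before `τ → ∞`, gives `errorProb_le` and
the limit.

Explicit bound. Each half of the sum is dominated by a geometric series. For the `Q` terms, the
ratio is `k₀ n exp(-x²/2)` with `x = (1 - 2η₀)√τ/2`; the threshold `Mbar₁` makes it at most `1/2`,
and a factor `1/x` tends to zero (`sum_choose_mul_gaussianQ_le`). For the Bessel terms, with `y = η₀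
τ`, the ratio is a constant times `k₀ n √y exp(-y/2)` (`sum_choose_mul_Psi_le`); it vanishes once
`k₀ n ≤ D exp(y/4)`. For fixed `L` and `k₀` both are immediate. Uniformly, `Mbar₂` gives `D = 2r₀ +
2` if `k₀ ≥ 2`; the case `k₀ = 1` needs the sharper estimate `Psi_one_le`. -/

namespace BlockRecovery

/-! ### Gaussian vectors: orthogonal invariance and tail estimates -/

section

open MeasureTheory ProbabilityTheory Matrix

/-- The law of a vector with i.i.d. standard Gaussian coordinates. -/
noncomputable abbrev stdGauss (ι : Type*) [Fintype ι] : Measure (ι → ℝ) :=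
  Measure.pi fun _ => gaussianReal 0 1

theorem dotProduct_mulVec_self_of_orthonormal {ι κ : Type*} [Fintype ι] [Fintype κ]
    [DecidableEq κ] (W : Matrix ι κ ℝ) (hW : W.transpose * W = 1) (t : κ → ℝ) :
    ∑ i, (W.mulVec t) i ^ 2 = ∑ i, t i ^ 2 := by
  have h : (W.mulVec t) ⬝ᵥ (W.mulVec t) = t ⬝ᵥ t := by
    rw [dotProduct_mulVec, vecMul_mulVec, hW, vecMul_one]
  simpa [dotProduct, sq] using h

/-- A matrix with orthonormal columns sends standard Gaussian vectors to standard Gaussian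
vectors. -/
theorem measurePreserving_vecMul {ι κ : Type*} [Fintype ι] [Fintype κ] [DecidableEq κ]
    (W : Matrix ι κ ℝ) (hW : W.transpose * W = 1) :
    MeasurePreserving (fun r : ι → ℝ => r ᵥ* W) (stdGauss ι) (stdGauss κ) := by
  have hm : Measurable (fun r : ι → ℝ => r ᵥ* W) := by
    apply Continuous.measurable
    fun_prop
  refine ⟨hm, ?_⟩
  have : IsFiniteMeasure ((stdGauss ι).map fun r => r ᵥ* W) := Measure.isFiniteMeasure_map _ _
  rw [← charFun_eq_pi_iff]
  intro t
  -- The characteristic function at `t` of the image is that of the source at `W t`, and it depends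
  -- only on `‖W t‖ = ‖t‖`.
  have h2 := charFun_pi (μ := fun _ : ι => gaussianReal 0 1) (WithLp.toLp 2 (W.mulVec t.ofLp))
  have h3 : charFun (Measure.map (WithLp.toLp 2) (Measure.map (fun r => r ᵥ* W) (stdGauss ι))) t
      = charFun (Measure.map (WithLp.toLp 2) (stdGauss ι)) (WithLp.toLp 2 (W.mulVec t.ofLp)) := by
    rw [charFun_apply, charFun_apply, Measure.map_map (by fun_prop) hm,
      integral_map (by fun_prop) (by fun_prop), integral_map (by fun_prop) (by fun_prop)]
    congr 1
    ext r
    congr 3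
    simp only [Function.comp, EuclideanSpace.inner_eq_star_dotProduct, star_trivial]
    rw [dotProduct_comm, ← dotProduct_mulVec, dotProduct_comm]
  rw [h3, h2]
  simp only [charFun_gaussianReal, ← Complex.exp_sum]
  congr 1
  have := dotProduct_mulVec_self_of_orthonormal W hW t.ofLp
  simp only [Complex.ofReal_zero, mul_zero, zero_mul, zero_sub, NNReal.coe_one, Complex.ofReal_one,
    one_mul, Finset.sum_neg_distrib, ← Finset.sum_div]
  congr 2
  exact_mod_cast this

theorem lintegral_sq_gaussianReal :
    ∫⁻ x, ENNReal.ofReal (x ^ 2) ∂(gaussianReal 0 1) = 1 := by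
  have h := variance_id_gaussianReal (μ := 0) (v := 1)
  rw [variance_eq_integral (by fun_prop)] at h
  simp at h
  rw [← ofReal_integral_eq_lintegral_ofReal, h]
  · simp
  · have := (memLp_id_gaussianReal (μ := 0) (v := 1) 2).integrable_sq
    simpa using this
  · exact Filter.Eventually.of_forall fun x => sq_nonneg x

theorem lintegral_sum_sq_stdGauss {ι κ : Type*} [Fintype ι] [Fintype κ] (f : κ → ι) :
    ∫⁻ w, ENNReal.ofReal (∑ j, w (f j) ^ 2) ∂(stdGauss ι) = Fintype.card κ := by
  have : ∀ w : ι → ℝ, ENNReal.ofReal (∑ j, w (f j) ^ 2) = ∑ j, ENNReal.ofReal (w (f j) ^ 2) :=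
    fun w => ENNReal.ofReal_sum_of_nonneg fun _ _ => sq_nonneg _
  simp_rw [this]
  rw [lintegral_finsetSum _ (by fun_prop)]
  have h1 : ∀ j, ∫⁻ w, ENNReal.ofReal (w (f j) ^ 2) ∂(stdGauss ι) = 1 := fun j => by
    rw [← lintegral_sq_gaussianReal]
    exact (measurePreserving_eval (fun _ : ι => gaussianReal 0 1) (f j)).lintegral_comp
      (f := fun x => ENNReal.ofReal (x ^ 2)) (by fun_prop)
  simp [h1]

theorem stdGauss_sum_sq_ge_le {ι κ : Type*} [Fintype ι] [Fintype κ] (f : κ → ι) {t : ℝ}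
    (ht : 0 < t) :
    stdGauss ι {w | t ≤ ∑ j, w (f j) ^ 2} ≤ ENNReal.ofReal (Fintype.card κ / t) := by
  have h := meas_ge_le_lintegral_div (μ := stdGauss ι)
    (f := fun w => ENNReal.ofReal (∑ j, w (f j) ^ 2)) (Measurable.aemeasurable (by fun_prop))
    (ε := ENNReal.ofReal t) (by simpa using ht) (by simp)
  rw [lintegral_sum_sq_stdGauss] at h
  rw [ENNReal.ofReal_div_of_pos ht, ENNReal.ofReal_natCast]
  refine le_trans (measure_mono ?_) h
  intro w hw
  exact ENNReal.ofReal_le_ofReal hw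

theorem integral_exp_neg_mul_sq_gaussianReal {u : ℝ} (hu : 0 < u) :
    ∫ x, Real.exp (-u * x ^ 2) ∂(gaussianReal 0 1) = 1 / Real.sqrt (1 + 2 * u) := by
  rw [integral_gaussianReal_eq_integral_smul (by simp)]
  simp only [gaussianPDFReal, smul_eq_mul, NNReal.coe_one, sub_zero, mul_one]
  have : ∀ x : ℝ, (Real.sqrt (2 * Real.pi))⁻¹ * Real.exp (-x ^ 2 / 2) * Real.exp (-u * x ^ 2)
      = (Real.sqrt (2 * Real.pi))⁻¹ * Real.exp (-(1 / 2 + u) * x ^ 2) := fun x => by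
    rw [mul_assoc, ← Real.exp_add]; congr 2; ring
  simp_rw [this]
  rw [integral_const_mul, integral_gaussian, ← Real.sqrt_inv, ← Real.sqrt_mul (by positivity),
    one_div (Real.sqrt _), ← Real.sqrt_inv]
  congr 1
  have := Real.pi_pos
  field_simp

/-- Lower tail of the chi-squared distribution. -/
theorem stdGauss_sum_sq_le_le {n : ℕ} (hn : 0 < n) {δ : ℝ} (hδ : 0 < δ) :
    stdGauss (Fin n) {g | ∑ j, g j ^ 2 ≤ n * δ} ≤
      ENNReal.ofReal (Real.sqrt (Real.exp 1 * δ)) := by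
  -- Beyond this case the claimed bound is below one, which later allows an `n`-th power to be
  -- replaced by a first power.
  by_cases h1 : 1 ≤ Real.exp 1 * δ
  · refine prob_le_one.trans ?_
    rw [ENNReal.one_le_ofReal]
    exact Real.one_le_sqrt.2 h1
  push Not at h1
  -- Chernoff parameter: `u δ = 1/2`, so each coordinate contributes `√e / √(1 + 1/δ) ≤ √(e δ)`.
  set u : ℝ := 1 / (2 * δ) with hu
  have hu0 : 0 < u := by positivity
  have hint : ∫ g, ∏ j, Real.exp (-u * g j ^ 2) ∂(stdGauss (Fin n))
      = (1 / Real.sqrt (1 + 2 * u)) ^ n := by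
    rw [integral_fintype_prod_eq_prod (f := fun _ x => Real.exp (-u * x ^ 2))]
    rw [Finset.prod_congr rfl fun _ _ => integral_exp_neg_mul_sq_gaussianReal hu0]
    simp
  have hc : Integrable (fun g : Fin n → ℝ => ∏ j, Real.exp (-u * g j ^ 2)) (stdGauss (Fin n)) := by
    refine Integrable.of_bound (Measurable.aestronglyMeasurable (by fun_prop)) 1 (Filter.Eventually.of_forall fun g => ?_)
    rw [Real.norm_of_nonneg (by positivity)]
    refine Finset.prod_le_one (fun _ _ => by positivity) fun _ _ => ?_
    rw [Real.exp_le_one_iff]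
    nlinarith [sq_nonneg (g ‹_›)]
  have hmk := mul_meas_ge_le_integral_of_nonneg
    (Filter.Eventually.of_forall fun g => by positivity) hc (Real.exp (-u * (n * δ)))
  rw [hint] at hmk
  have hsub : {g : Fin n → ℝ | ∑ j, g j ^ 2 ≤ n * δ} ⊆
      {g | Real.exp (-u * (n * δ)) ≤ ∏ j, Real.exp (-u * g j ^ 2)} := by
    intro g hg
    simp only [Set.mem_ofPred_eq] at hg ⊢
    rw [← Real.exp_sum, Real.exp_le_exp, ← Finset.mul_sum]
    nlinarith
  rw [← ofReal_measureReal]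
  refine ENNReal.ofReal_le_ofReal ((measureReal_mono hsub).trans ?_)
  have hθ : Real.exp (u * δ) * (1 / Real.sqrt (1 + 2 * u)) ≤ Real.sqrt (Real.exp 1 * δ) := by
    have e1 : u * δ = 1 / 2 := by rw [hu]; field_simp
    rw [e1, Real.sqrt_mul (by positivity), ← Real.exp_half]
    refine mul_le_mul_of_nonneg_left ?_ (by positivity)
    rw [one_div, ← Real.sqrt_inv]
    refine Real.sqrt_le_sqrt ?_
    have : 1 + 2 * u = (δ + 1) / δ := by rw [hu]; field_simp
    rw [this, inv_div, div_le_iff₀ (by positivity)]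
    nlinarith
  have hexp : Real.exp (-u * (n * δ)) * Real.exp (u * δ) ^ n = 1 := by
    rw [← Real.exp_nat_mul, ← Real.exp_add]; simp; ring
  have hle : (stdGauss (Fin n)).real {g | Real.exp (-u * (n * δ)) ≤ ∏ j, Real.exp (-u * g j ^ 2)}
      ≤ (Real.exp (u * δ) * (1 / Real.sqrt (1 + 2 * u))) ^ n := by
    rw [mul_pow]
    calc _ = Real.exp (u * δ) ^ n * (Real.exp (-u * (n * δ)) * (stdGauss (Fin n)).real
            {g | Real.exp (-u * (n * δ)) ≤ ∏ j, Real.exp (-u * g j ^ 2)}) := by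
          rw [← mul_assoc (Real.exp (u * δ) ^ n), mul_comm (Real.exp (u * δ) ^ n), hexp, one_mul]
      _ ≤ _ := by gcongr
  refine hle.trans ((pow_le_of_le_one (by positivity) (hθ.trans ?_) hn.ne').trans hθ)
  exact Real.sqrt_le_one.2 h1.le

/-- For `a ≠ 0` the variable `⟨a, b⟩ / ‖a‖` is standard Gaussian, so this is Chebyshev's inequality.
The strict inequality makes the event empty for `a = 0`. -/
theorem stdGauss_sq_dotProduct_gt_le {n : ℕ} (a : Fin n → ℝ) {t : ℝ} (ht : 0 < t) :
    stdGauss (Fin n) {b | t * (∑ i, a i ^ 2) < (∑ i, a i * b i) ^ 2} ≤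
      ENNReal.ofReal (1 / t) := by
  by_cases ha : 0 < ∑ i, a i ^ 2
  swap
  · have h0 : ∑ i, a i ^ 2 = 0 := le_antisymm (not_lt.1 ha) (by positivity)
    rw [Finset.sum_eq_zero_iff_of_nonneg fun _ _ => sq_nonneg _] at h0
    have h1 : ∀ i, a i = 0 := fun i => by simpa using h0 i (Finset.mem_univ i)
    simp [h1]
  set s := Real.sqrt (∑ i, a i ^ 2) with hs
  have hs0 : 0 < s := Real.sqrt_pos.2 ha
  have hs2 : s ^ 2 = ∑ i, a i ^ 2 := Real.sq_sqrt ha.le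
  let W : Matrix (Fin n) Unit ℝ := Matrix.of fun i _ => a i / s
  have hW : W.transpose * W = 1 := by
    ext i j
    simp only [W, Matrix.mul_apply, Matrix.transpose_apply, Matrix.of_apply, ← sq, div_pow,
      ← Finset.sum_div, Matrix.one_apply]
    rw [← hs2]
    simp [hs0.ne']
  have h := stdGauss_sum_sq_ge_le (id : Unit → Unit) ht
  rw [← (measurePreserving_vecMul W hW).measure_preimage
    (measurableSet_le (by fun_prop) (by fun_prop)).nullMeasurableSet] at h
  simp only [Fintype.card_unit, Nat.cast_one] at h
  refine le_trans (measure_mono ?_) h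
  intro b hb
  simp only [Finset.univ_unique, id_eq, Finset.sum_const, Finset.card_singleton, one_smul,
    Set.preimage_ofPred_eq, Set.mem_ofPred_eq, Matrix.vecMul, dotProduct, W, Matrix.of_apply]
  have : ∑ i, b i * (a i / s) = (∑ i, a i * b i) / s := by
    rw [Finset.sum_div]; exact Finset.sum_congr rfl fun i _ => by ring
  rw [this, div_pow, le_div_iff₀ (by positivity), hs2]
  exact (show _ < _ from hb).le

end

/-! ### Least squares residuals against a fixed column space -/

section

open MeasureTheory ProbabilityTheory Matrix

/-- The column space has dimension at most `k`, so its orthogonal complement contains `n`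
orthonormal vectors, which extend to a basis. The rank of `B` may be smaller than `k`. -/
theorem exists_orthogonal_matrix_annihilating {M n k : ℕ} {κ : Type*} [Fintype κ]
    (B : Matrix (Fin M) κ ℝ) (hk : Fintype.card κ = k) (hM : n + k = M) :
    ∃ O : Matrix (Fin M) (Fin n ⊕ Fin k) ℝ, O.transpose * O = 1 ∧ O * O.transpose = 1 ∧
      ∀ x i, (B.mulVec x ᵥ* O) (Sum.inl i) = 0 := by
  classical
  let S : Submodule ℝ (EuclideanSpace ℝ (Fin M)) :=
    Submodule.span ℝ (Set.range fun j => WithLp.toLp 2 fun m => B m j)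
  have hS : Module.finrank ℝ S ≤ k := hk ▸ finrank_range_le_card _
  have hS' : n ≤ Module.finrank ℝ Sᗮ := by
    have := S.finrank_add_finrank_orthogonal
    rw [finrank_euclideanSpace_fin] at this
    omega
  -- The zeros on `Fin k` are placeholders; the extension theorem keeps only the values on the left
  -- summand.
  let v : Fin n ⊕ Fin k → EuclideanSpace ℝ (Fin M) :=
    Sum.elim (fun i => (stdOrthonormalBasis ℝ Sᗮ (Fin.castLE hS' i) : EuclideanSpace ℝ (Fin M))) 0
  have hv : Orthonormal ℝ ((Set.range Sum.inl : Set (Fin n ⊕ Fin k)).domRestrict v) := by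
    have h0 := (stdOrthonormalBasis ℝ Sᗮ).orthonormal
    have h1 := (h0.comp (Fin.castLE hS') (Fin.castLE_injective hS')).comp_linearIsometry
      Sᗮ.subtypeₗᵢ
    rw [orthonormal_iff_ite] at h1 ⊢
    rintro ⟨_, i, rfl⟩ ⟨_, j, rfl⟩
    simpa [v, Set.domRestrict, Subtype.ext_iff] using h1 i j
  obtain ⟨b, hb⟩ := hv.exists_orthonormalBasis_extension_of_card_eq (by simp [hM])
  let O : Matrix (Fin M) (Fin n ⊕ Fin k) ℝ := Matrix.of fun m j => b j m
  have hO : O.transpose * O = 1 := by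
    ext i j
    have := orthonormal_iff_ite.1 b.orthonormal i j
    rw [Matrix.one_apply, ← this, Matrix.mul_apply, PiLp.inner_apply]
    exact Finset.sum_congr rfl fun m _ => by simp [O, mul_comm]
  refine ⟨O, hO, (Matrix.mul_eq_one_comm_of_card_eq _ _ _ (by simp [hM])).1 hO, fun x i => ?_⟩
  have hmem : b (Sum.inl i) ∈ Sᗮ := by
    rw [hb _ ⟨i, rfl⟩]
    exact (stdOrthonormalBasis ℝ Sᗮ (Fin.castLE hS' i)).2
  have hc : ∀ j, ∑ m, B m j * b (Sum.inl i) m = 0 := fun j => by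
    have := (Submodule.mem_orthogonal _ _).1 hmem _ (Submodule.subset_span ⟨j, rfl⟩)
    rw [PiLp.inner_apply] at this
    simpa [mul_comm] using this
  simp only [Matrix.vecMul, Matrix.mulVec, dotProduct, O, Matrix.of_apply, Finset.sum_mul]
  rw [Finset.sum_comm]
  refine Finset.sum_eq_zero fun j _ => ?_
  calc _ = x j * ∑ m, B m j * b (Sum.inl i) m := by
        rw [Finset.mul_sum]; exact Finset.sum_congr rfl fun m _ => by ring
    _ = 0 := by rw [hc, mul_zero]

theorem measurePreserving_comp_inl (n k : ℕ) :
    MeasurePreserving (fun (w : Fin n ⊕ Fin k → ℝ) i => w (Sum.inl i))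
      (stdGauss (Fin n ⊕ Fin k)) (stdGauss (Fin n)) :=
  measurePreserving_fst.comp
    (measurePreserving_sumPiEquivProdPi (fun _ : Fin n ⊕ Fin k => gaussianReal 0 1))

/-- With `Z = ‖a‖²` and `X = ⟨a, b⟩` on the first `n` coordinates, the event lies in the union of
`ρ² Z ≤ T`, of noise energy at least `T/4` in the last `k` coordinates, and of `X² > T Z / 16`. The
summands of the bound are the lower chi-squared tail, Markov's inequality and, conditionally on `a`,
Chebyshev's inequality. -/
theorem stdGauss_prod_quadratic_event_le {n k : ℕ} (hn : 0 < n) {ρ T : ℝ} (hρ : 0 < ρ)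
    (hT : 4 ≤ T) :
    (stdGauss (Fin n ⊕ Fin k)).prod (stdGauss (Fin n ⊕ Fin k))
      {p | ρ ^ 2 * ∑ i, p.1 (Sum.inl i) ^ 2 + 2 * ρ * ∑ i, p.1 (Sum.inl i) * p.2 (Sum.inl i) <
        ∑ j, p.2 (Sum.inr j) ^ 2 + 1} ≤
      ENNReal.ofReal (Real.sqrt (Real.exp 1 * (T / (n * ρ ^ 2))) + (4 * k + 16) / T) := by
  set γ := stdGauss (Fin n ⊕ Fin k)
  set δ : ℝ := T / (n * ρ ^ 2) with hδ
  have hn' : (0 : ℝ) < n := by exact_mod_cast hn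
  have hT0 : 0 < T := by linarith
  have hδ0 : 0 < δ := by positivity
  let E₁ : Set (Fin n ⊕ Fin k → ℝ) := {a | ∑ i, a (Sum.inl i) ^ 2 ≤ n * δ}
  let E₂ : Set (Fin n ⊕ Fin k → ℝ) := {b | T / 4 ≤ ∑ i, b (Sum.inr i) ^ 2}
  let E₃ : Set ((Fin n ⊕ Fin k → ℝ) × (Fin n ⊕ Fin k → ℝ)) :=
    {p | T / 16 * (∑ i, p.1 (Sum.inl i) ^ 2) < (∑ i, p.1 (Sum.inl i) * p.2 (Sum.inl i)) ^ 2}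
  have h₁ : (γ.prod γ) (E₁ ×ˢ Set.univ) ≤ ENNReal.ofReal (Real.sqrt (Real.exp 1 * δ)) := by
    rw [Measure.prod_prod, measure_univ, mul_one]
    refine le_trans (le_of_eq ?_) (stdGauss_sum_sq_le_le hn hδ0)
    have hm : MeasurableSet {g : Fin n → ℝ | ∑ j, g j ^ 2 ≤ n * δ} :=
      measurableSet_le (by fun_prop) (by fun_prop)
    exact (measurePreserving_comp_inl n k).measure_preimage hm.nullMeasurableSet
  have h₂ : (γ.prod γ) (Set.univ ×ˢ E₂) ≤ ENNReal.ofReal (4 * k / T) := by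
    rw [Measure.prod_prod, measure_univ, one_mul]
    refine (stdGauss_sum_sq_ge_le Sum.inr (by positivity : 0 < T / 4)).trans ?_
    refine ENNReal.ofReal_le_ofReal (le_of_eq ?_)
    rw [Fintype.card_fin]; field_simp
  have h₃ : (γ.prod γ) E₃ ≤ ENNReal.ofReal (16 / T) := by
    have hm : MeasurableSet E₃ := measurableSet_lt (by fun_prop) (by fun_prop)
    rw [Measure.prod_apply hm]
    have hb : ∀ a, γ (Prod.mk a ⁻¹' E₃) ≤ ENNReal.ofReal (16 / T) := fun a => by
      have h := stdGauss_sq_dotProduct_gt_le (fun i => a (Sum.inl i))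
        (by positivity : 0 < T / 16)
      rw [one_div_div] at h
      refine le_trans (le_of_eq ?_) h
      have hm' : MeasurableSet {b : Fin n → ℝ | T / 16 * (∑ i, a (Sum.inl i) ^ 2) <
          (∑ i, a (Sum.inl i) * b i) ^ 2} := measurableSet_lt (by fun_prop) (by fun_prop)
      exact (measurePreserving_comp_inl n k).measure_preimage hm'.nullMeasurableSet
    refine (lintegral_mono hb).trans ?_
    simp
  have hsub : {p : (Fin n ⊕ Fin k → ℝ) × (Fin n ⊕ Fin k → ℝ) |
      ρ ^ 2 * ∑ i, p.1 (Sum.inl i) ^ 2 + 2 * ρ * ∑ i, p.1 (Sum.inl i) * p.2 (Sum.inl i) <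
        ∑ j, p.2 (Sum.inr j) ^ 2 + 1} ⊆ E₁ ×ˢ Set.univ ∪ Set.univ ×ˢ E₂ ∪ E₃ := by
    rintro ⟨a, b⟩ hp
    simp only [Set.mem_ofPred_eq] at hp
    by_cases h1 : ∑ i, a (Sum.inl i) ^ 2 ≤ n * δ
    · exact Or.inl (Or.inl ⟨h1, trivial⟩)
    by_cases h2 : T / 4 ≤ ∑ i, b (Sum.inr i) ^ 2
    · exact Or.inl (Or.inr ⟨trivial, h2⟩)
    refine Or.inr ?_
    push Not at h1 h2
    change T / 16 * (∑ i, a (Sum.inl i) ^ 2) < (∑ i, a (Sum.inl i) * b (Sum.inl i)) ^ 2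
    set Z := ∑ i, a (Sum.inl i) ^ 2
    set X := ∑ i, a (Sum.inl i) * b (Sum.inl i)
    have hZ : T < ρ ^ 2 * Z := by
      have : ρ ^ 2 * (n * δ) = T := by rw [hδ]; field_simp
      rw [← this]; gcongr
    have hZ0 : 0 < Z := lt_trans (by positivity) h1
    -- As `T ≥ 4`, the right side of the event is below `T/4 + 1 ≤ T/2 < ρ² Z / 2`, so the cross
    -- term `2ρX` must be less than `-ρ² Z / 2`.
    have hX : ρ * Z < 4 * (-X) := by
      have : ρ * (ρ * Z) < ρ * (4 * (-X)) := by nlinarith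
      exact lt_of_mul_lt_mul_left this hρ.le
    have hX2 : (ρ * Z) ^ 2 < (4 * (-X)) ^ 2 := by
      have : 0 < ρ * Z := by positivity
      gcongr
    nlinarith [mul_le_mul_of_nonneg_right hZ.le hZ0.le]
  refine (measure_mono hsub).trans ((measure_union_le _ _).trans ?_)
  refine (add_le_add_left ((measure_union_le _ _).trans (add_le_add h₁ h₂)) _).trans ?_
  refine (add_le_add_right h₃ _).trans ?_
  rw [← ENNReal.ofReal_add (by positivity) (by positivity),
    ← ENNReal.ofReal_add (by positivity) (by positivity)]
  exact ENNReal.ofReal_le_ofReal (le_of_eq (by ring))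

/-- Observations whose least squares residual over the column space of `B` is nearly
as small as the noise are unlikely. -/
theorem stdGauss_prod_residual_event_le {M : ℕ} {κ : Type*} [Fintype κ]
    (B : Matrix (Fin M) κ ℝ) (hM : Fintype.card κ < M) {ρ T : ℝ} (hρ : 0 < ρ) (hT : 4 ≤ T) :
    (stdGauss (Fin M)).prod (stdGauss (Fin M))
      {p | ∃ x, ∑ m, (ρ * p.1 m + p.2 m - B.mulVec x m) ^ 2 < ∑ m, p.2 m ^ 2 + 1} ≤
      ENNReal.ofReal (Real.sqrt (Real.exp 1 * (T / (((M : ℝ) - Fintype.card κ) * ρ ^ 2))) +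
        (4 * Fintype.card κ + 16) / T) := by
  obtain ⟨n, hn⟩ := Nat.exists_eq_add_of_lt hM
  set k := Fintype.card κ with hk
  obtain ⟨O, hO, hO', hB⟩ := exists_orthogonal_matrix_annihilating (n := n + 1) B hk.symm
    (by omega)
  have hn' : (M : ℝ) - k = (n + 1 : ℕ) := by rw [hn]; push_cast; ring
  rw [hn']
  refine le_trans ?_ (stdGauss_prod_quadratic_event_le (n := n + 1) (k := k) n.succ_pos hρ hT)
  have hmp := (measurePreserving_vecMul O hO).prod (measurePreserving_vecMul O hO)
  rw [← hmp.measure_preimage (measurableSet_lt (by fun_prop) (by fun_prop)).nullMeasurableSet]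
  refine measure_mono ?_
  rintro ⟨g, w⟩ ⟨x, hx⟩
  have hnorm : ∀ v : Fin M → ℝ, ∑ m, v m ^ 2 = ∑ j, (v ᵥ* O) j ^ 2 := fun v => by
    rw [← dotProduct_mulVec_self_of_orthonormal O.transpose (by simpa using hO') v]
    simp only [mulVec_transpose]
  simp only [Set.preimage_ofPred_eq, Set.mem_ofPred_eq, Prod.map_fst, Prod.map_snd]
  have e := hnorm (ρ • g + w - B.mulVec x)
  rw [hnorm w] at hx
  simp only [Pi.add_apply, Pi.sub_apply, Pi.smul_apply, smul_eq_mul] at e hx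
  rw [e, sub_vecMul, add_vecMul, smul_vecMul, Fintype.sum_sum_type, Fintype.sum_sum_type] at hx
  simp only [Pi.add_apply, Pi.sub_apply, Pi.smul_apply, smul_eq_mul, hB, sub_zero] at hx
  -- In the last `k` coordinates the fit may be perfect, so only nonnegativity of the residual is
  -- kept there; in the others `B x` vanishes and the noise energy cancels.
  have hnn : 0 ≤ ∑ j, (ρ * (g ᵥ* O) (Sum.inr j) + (w ᵥ* O) (Sum.inr j)
      - (B.mulVec x ᵥ* O) (Sum.inr j)) ^ 2 := Finset.sum_nonneg fun _ _ => sq_nonneg _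
  have hexp : ∑ i, (ρ * (g ᵥ* O) (Sum.inl i) + (w ᵥ* O) (Sum.inl i)) ^ 2
      = ρ ^ 2 * ∑ i, (g ᵥ* O) (Sum.inl i) ^ 2
        + 2 * ρ * ∑ i, (g ᵥ* O) (Sum.inl i) * (w ᵥ* O) (Sum.inl i)
        + ∑ i, (w ᵥ* O) (Sum.inl i) ^ 2 := by
    rw [Finset.mul_sum, Finset.mul_sum, ← Finset.sum_add_distrib, ← Finset.sum_add_distrib]
    exact Finset.sum_congr rfl fun i _ => by ring
  linarith

end

/-! ### From maximum likelihood decoding to the residual event -/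

section

open MeasureTheory ProbabilityTheory Matrix

/-- Linear combinations, with orthonormal coefficient vectors, of the columns of a Gaussian matrix
form a Gaussian matrix; here the last column is singled out. -/
theorem measurePreserving_columns {M : ℕ} {ι κ : Type*} [Fintype ι] [Fintype κ] [DecidableEq κ]
    (W : Matrix ι (κ ⊕ Unit) ℝ) (hW : W.transpose * W = 1) :
    MeasurePreserving (fun A : Fin M → ι → ℝ =>
        ((fun m p => (A m ᵥ* W) (Sum.inl p) : Fin M → κ → ℝ),
          (fun m => (A m ᵥ* W) (Sum.inr ()) : Fin M → ℝ)))
      (Measure.pi fun _ => stdGauss ι) ((Measure.pi fun _ => stdGauss κ).prod (stdGauss (Fin M))) := by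
  have h1 : MeasurePreserving (fun (A : Fin M → ι → ℝ) m =>
      (MeasurableEquiv.sumPiEquivProdPi fun _ : κ ⊕ Unit => ℝ) (A m ᵥ* W))
      (Measure.pi fun _ => stdGauss ι)
      (Measure.pi fun _ => (stdGauss κ).prod (stdGauss Unit)) :=
    measurePreserving_pi _ _ fun _ =>
      (measurePreserving_sumPiEquivProdPi (fun _ : κ ⊕ Unit => gaussianReal 0 1)).comp
        (measurePreserving_vecMul W hW)
  have h2 := measurePreserving_arrowProdEquivProdArrow (κ → ℝ) (Unit → ℝ) (Fin M)
    (fun _ => stdGauss κ) (fun _ => stdGauss Unit)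
  have h3 : MeasurePreserving (fun (f : Fin M → Unit → ℝ) m => f m ())
      (Measure.pi fun _ => stdGauss Unit) (stdGauss (Fin M)) :=
    measurePreserving_pi _ _ fun _ => measurePreserving_eval (fun _ : Unit => gaussianReal 0 1) ()
  exact ((MeasurePreserving.id _).prod h3).comp (h2.comp h1)

/-- The set of tuples (matrix, signal direction, noise) for which some combination of the columns
of the matrix approximates the observation as well as the noise level allows. -/
def residualEvent (M : ℕ) (κ : Type*) [Fintype κ] (ρ : ℝ) :
    Set ((Fin M → κ → ℝ) × ((Fin M → ℝ) × (Fin M → ℝ))) :=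
  {p | ∃ x, ∑ m, (ρ * p.2.1 m + p.2.2 m - (Matrix.of p.1).mulVec x m) ^ 2 <
    ∑ m, p.2.2 m ^ 2 + 1}

/-- The slack `+ 1` permits a strict inequality, so the event is a union of open sets over
uncountably many `x`, hence measurable. The decoding event, for an arbitrary decoder, need not be
measurable and is only included in a preimage of this one. -/
theorem isOpen_residualEvent (M : ℕ) (κ : Type*) [Fintype κ] (ρ : ℝ) :
    IsOpen (residualEvent M κ ρ) := by
  have : residualEvent M κ ρ = ⋃ x, {p | ∑ m, (ρ * p.2.1 m + p.2.2 m -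
      (Matrix.of p.1).mulVec x m) ^ 2 < ∑ m, p.2.2 m ^ 2 + 1} := by
    ext p; simp [residualEvent]
  rw [this]
  refine isOpen_iUnion fun x => isOpen_lt ?_ (by fun_prop)
  simp only [Matrix.mulVec, dotProduct, Matrix.of_apply]
  fun_prop

/-- Fubini: the estimate for a fixed matrix does not depend on that matrix. -/
theorem measure_residualEvent_le {M : ℕ} {κ : Type*} [Fintype κ]
    (hM : Fintype.card κ < M) {ρ T : ℝ} (hρ : 0 < ρ) (hT : 4 ≤ T) :
    ((Measure.pi fun _ : Fin M => stdGauss κ).prod ((stdGauss (Fin M)).prod (stdGauss (Fin M))))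
      (residualEvent M κ ρ) ≤
      ENNReal.ofReal (Real.sqrt (Real.exp 1 * (T / (((M : ℝ) - Fintype.card κ) * ρ ^ 2))) +
        (4 * Fintype.card κ + 16) / T) := by
  rw [Measure.prod_apply (isOpen_residualEvent M κ ρ).measurableSet]
  refine (lintegral_mono fun B =>
    stdGauss_prod_residual_event_le (Matrix.of B) hM hρ hT).trans ?_
  simp

theorem sum_sq_le_of_likelihood_le {L d M : ℕ} {σ : ℝ} (hσ : 0 < σ)
    {A : Fin M → Fin (L * d) → ℝ} {V : Matrix (Fin (L * d)) (Fin L × Fin d) ℝ}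
    {c c' : BlockVec L d} {y : Fin M → ℝ} (h : likelihood σ A V c y ≤ likelihood σ A V c' y) :
    ∑ m, (y m - samples A V c' m) ^ 2 ≤ ∑ m, (y m - samples A V c m) ^ 2 := by
  have hv : ((σ ^ 2).toNNReal : ℝ) = σ ^ 2 := Real.coe_toNNReal _ (by positivity)
  simp only [likelihood, gaussianPDFReal, Finset.prod_mul_distrib, hv, ← Real.exp_sum,
    ← Finset.sum_div, Finset.sum_neg_distrib] at h
  have hpos : 0 < ∏ _m : Fin M, (Real.sqrt (2 * Real.pi * σ ^ 2))⁻¹ :=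
    Finset.prod_pos fun _ _ => by positivity
  have h1 := Real.exp_le_exp.1 (le_of_mul_le_mul_left h hpos)
  rw [div_le_div_iff_of_pos_right (by positivity)] at h1
  linarith

theorem exists_blockSNR_le {L d k₀ : ℕ} {σ : ℝ} {c : BlockSupport L k₀ → BlockVec L d}
    (U : BlockSupport L k₀) {m : Fin L} (hm : c U m ≠ 0) :
    bsnrMin σ c ≤ ‖c U m‖ ^ 2 / σ ^ 2 :=
  (ciInf_le (Set.finite_range _).bddBelow U).trans
    (ciInf_le (f := fun m : {m : Fin L // c U m ≠ 0} => ‖c U m.1‖ ^ 2 / σ ^ 2)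
      (Set.finite_range _).bddBelow ⟨m, hm⟩)

section Separation

variable {L d k₀ M : ℕ} (U' : Finset (Fin L)) (h : BlockVec L d) (s : ℝ)

/-- Columns: the coordinate vectors of the blocks in `U'`, and the vector `h / s`. -/
noncomputable def selection :
    Matrix (Fin L × Fin d) ({p : Fin L × Fin d // p.1 ∈ U'} ⊕ Unit) ℝ :=
  Matrix.of fun q => Sum.elim (fun p => if q = p.1 then 1 else 0) fun _ => h q.1 q.2 / s

theorem selection_orthonormal (hh : ∀ m ∈ U', h m = 0) (hs : s ≠ 0)
    (hs2 : s ^ 2 = ∑ q : Fin L × Fin d, h q.1 q.2 ^ 2) :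
    (selection U' h s).transpose * selection U' h s = 1 := by
  ext i j
  rw [Matrix.mul_apply]
  simp only [selection, Matrix.transpose_apply, Matrix.of_apply]
  rcases i with i | i <;> rcases j with j | j
  · simp [Matrix.one_apply, Subtype.ext_iff, eq_comm]
  · simp [hh i.1.1 i.2]
  · simp [hh j.1.1 j.2]
  · simp only [Sum.elim_inr, ← sq, div_pow, ← Finset.sum_div]
    rw [← hs2]
    simp [hs]

/-- Splits a row of the samples of `c - chat`: outside `U'` only `c` survives, and the discrepancy
inside `U'` is a combination of the columns that the residual may use freely. -/
theorem sum_subtype_add_sum_eq {a : Fin L × Fin d → ℝ} {c chat : BlockVec L d}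
    (hchat : SupportedIn chat U') :
    ∑ q : Fin L × Fin d, a q * (if q.1 ∈ U' then 0 else c q.1) q.2 -
      ∑ p : {p : Fin L × Fin d // p.1 ∈ U'}, a p.1 * (chat p.1.1 p.1.2 - c p.1.1 p.1.2) =
    ∑ q, a q * c q.1 q.2 - ∑ q, a q * chat q.1 q.2 := by
  classical
  have h1 : ∑ p : {p : Fin L × Fin d // p.1 ∈ U'}, a p.1 * (chat p.1.1 p.1.2 - c p.1.1 p.1.2) =
      ∑ q : Fin L × Fin d, if q.1 ∈ U' then a q * (chat q.1 q.2 - c q.1 q.2) else 0 := by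
    rw [← Finset.sum_filter]
    exact (Finset.sum_subtype _ (by simp)
      (fun q : Fin L × Fin d => a q * (chat q.1 q.2 - c q.1 q.2))).symm
  rw [h1, ← Finset.sum_sub_distrib, ← Finset.sum_sub_distrib]
  refine Finset.sum_congr rfl fun q _ => ?_
  by_cases hq : q.1 ∈ U'
  · simp [hq]; ring
  · simp [hq, hchat q.1 hq]

end Separation

theorem card_block_positions {L d k₀ : ℕ} (U' : BlockSupport L k₀) :
    Fintype.card {p : Fin L × Fin d // p.1 ∈ U'.1} = k₀ * d := by
  classical
  rw [Fintype.card_subtype]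
  have : (Finset.univ.filter fun p : Fin L × Fin d => p.1 ∈ U'.1) = U'.1 ×ˢ Finset.univ := by
    ext p; simp
  rw [this, Finset.card_product, U'.2]
  simp

/-- Probability that a maximum likelihood decoder returns a given wrong support. -/
theorem measure_decode_eq_le {L d M k₀ : ℕ} {σ T : ℝ} (hσ : 0 < σ)
    {V : Matrix (Fin (L * d)) (Fin L × Fin d) ℝ} (hV : V.transpose * V = 1)
    {c : BlockSupport L k₀ → BlockVec L d} (hc : ∀ U, HasBlockSupport (c U) U.1)
    {ζ : (Fin M → Fin (L * d) → ℝ) → (Fin M → ℝ) → BlockSupport L k₀}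
    (hζ : IsMLDecoder σ V ζ) (hM : k₀ * d < M) (hB : 0 < bsnrMin σ c) (hT : 4 ≤ T)
    {U U' : BlockSupport L k₀} (hne : U' ≠ U) :
    jointLaw M (L * d) σ {p | ζ p.1 (samples p.1 V (c U) + p.2) = U'} ≤
      ENNReal.ofReal (Real.sqrt (Real.exp 1 * (T / (((M : ℝ) - (k₀ * d : ℕ)) * bsnrMin σ c))) +
        (4 * (k₀ * d : ℕ) + 16) / T) := by
  classical
  set κ := {p : Fin L × Fin d // p.1 ∈ U'.1} with hκ
  have hcard : Fintype.card κ = k₀ * d := card_block_positions U'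
  -- The part of the true signal that the blocks of `U'` cannot reproduce.
  let h : BlockVec L d := fun m => if m ∈ U'.1 then 0 else c U m
  set s : ℝ := Real.sqrt (∑ q : Fin L × Fin d, h q.1 q.2 ^ 2) with hs
  have hs2 : s ^ 2 = ∑ q : Fin L × Fin d, h q.1 q.2 ^ 2 :=
    Real.sq_sqrt (Finset.sum_nonneg fun _ _ => sq_nonneg _)
  have hsB : σ ^ 2 * bsnrMin σ c ≤ s ^ 2 := by
    -- Two distinct sets of equal size: some block of `U` is missed by `U'`, and its whole energy is
    -- in `h`.
    obtain ⟨m, hmU, hmU'⟩ : ∃ m ∈ U.1, m ∉ U'.1 := by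
      by_contra! hsub
      exact hne (Subtype.ext (Finset.eq_of_subset_of_card_le hsub (by rw [U.2, U'.2])).symm)
    have h1 := exists_blockSNR_le (σ := σ) U ((hc U m).1 hmU)
    rw [le_div_iff₀ (by positivity)] at h1
    have h2 : ‖c U m‖ ^ 2 ≤ s ^ 2 := by
      rw [hs2, Fintype.sum_prod_type, EuclideanSpace.real_norm_sq_eq]
      refine le_trans (le_of_eq ?_) (Finset.single_le_sum (f := fun x => ∑ y, h x y ^ 2)
        (fun _ _ => Finset.sum_nonneg fun _ _ => sq_nonneg _) (Finset.mem_univ m))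
      simp [h, hmU']
    linarith
  have hs0 : 0 < s := by
    refine lt_of_le_of_ne (Real.sqrt_nonneg _) fun h0 => ?_
    rw [← h0] at hsB
    have : 0 < σ ^ 2 * bsnrMin σ c := by positivity
    linarith
  have hh : ∀ m ∈ U'.1, h m = 0 := fun m hm => by simp [h, hm]
  set W := V * selection U'.1 h s with hW
  have hWo : W.transpose * W = 1 := by
    rw [hW, Matrix.transpose_mul, Matrix.mul_assoc, ← Matrix.mul_assoc V.transpose, hV,
      Matrix.one_mul, selection_orthonormal U'.1 h s hh hs0.ne' hs2]
  set ρ : ℝ := s / σ with hρ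
  have hρ0 : 0 < ρ := by positivity
  have hρB : bsnrMin σ c ≤ ρ ^ 2 := by
    rw [hρ, div_pow, le_div_iff₀ (by positivity)]; linarith
  have hnoise : MeasurePreserving (fun (w : Fin M → ℝ) m => σ⁻¹ * w m)
      (Measure.pi fun _ => gaussianReal 0 (σ ^ 2).toNNReal) (stdGauss (Fin M)) := by
    refine measurePreserving_pi _ _ fun _ => ⟨by fun_prop, ?_⟩
    rw [gaussianReal_map_const_mul]
    congr 1
    · simp
    · ext
      simp only [NNReal.coe_mul, NNReal.coe_mk, Real.coe_toNNReal _ (sq_nonneg σ), NNReal.coe_one]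
      field_simp
  have hmp := (measurePreserving_prodAssoc _ _ _).comp
    ((measurePreserving_columns (M := M) W hWo).prod hnoise)
  have hbound := measure_residualEvent_le (M := M) (κ := κ) (by rw [hcard]; exact hM) hρ0 hT
  rw [← hmp.measure_preimage (isOpen_residualEvent M κ ρ).measurableSet.nullMeasurableSet,
    hcard] at hbound
  have hMk : (0 : ℝ) < (M : ℝ) - (k₀ * d : ℕ) := by
    rw [sub_pos]; exact_mod_cast hM
  refine (measure_mono ?_).trans (hbound.trans (ENNReal.ofReal_le_ofReal (by gcongr)))
  rintro ⟨A, w⟩ hp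
  simp only [Set.mem_ofPred_eq] at hp
  obtain ⟨chat, hsupp, hmax⟩ := hζ A (samples A V (c U) + w)
  rw [hp] at hsupp
  -- The true coefficients compete in the maximization, and their residual is the noise.
  have hres := sum_sq_le_of_likelihood_le hσ
    (hmax U (c U) fun m hm => by simpa using mt (hc U m).2 hm)
  -- After division by `σ`, this witness turns the residual of the event into that of `chat`.
  refine ⟨fun p => (chat p.1.1 p.1.2 - c U p.1.1 p.1.2) / σ, ?_⟩
  have key : ∀ m, ρ * (A m ᵥ* W) (Sum.inr ()) + σ⁻¹ * w m -
      (Matrix.of fun m (p : κ) => (A m ᵥ* W) (Sum.inl p)).mulVec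
        (fun p => (chat p.1.1 p.1.2 - c U p.1.1 p.1.2) / σ) m
      = σ⁻¹ * ((samples A V (c U) + w) m - samples A V chat m) := fun m => by
    have hrow : ∀ j, (A m ᵥ* W) j = ((Matrix.of A * V) m ᵥ* selection U'.1 h s) j := fun j => by
      rw [hW, ← Matrix.vecMul_vecMul]; rfl
    have hsum := sum_subtype_add_sum_eq (c := c U) U'.1 (a := (Matrix.of A * V) m) hsupp
    have e1 : (A m ᵥ* W) (Sum.inr ()) = (∑ q, (Matrix.of A * V) m q * h q.1 q.2) / s := by
      rw [hrow, Finset.sum_div]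
      exact Finset.sum_congr rfl fun q _ => by simp [selection]; ring
    have e2 : ∀ p : κ, (A m ᵥ* W) (Sum.inl p) = (Matrix.of A * V) m p.1 := fun p => by
      rw [hrow]
      simp [Matrix.vecMul, dotProduct, selection]
    have e3 : (Matrix.of fun m (p : κ) => (A m ᵥ* W) (Sum.inl p)).mulVec
        (fun p => (chat p.1.1 p.1.2 - c U p.1.1 p.1.2) / σ) m =
        (∑ p : κ, (Matrix.of A * V) m p.1 * (chat p.1.1 p.1.2 - c U p.1.1 p.1.2)) / σ := by
      simp only [Matrix.mulVec, dotProduct, Matrix.of_apply, e2]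
      rw [Finset.sum_div]
      exact Finset.sum_congr rfl fun p _ => by ring
    have e4 : ∀ c' : BlockVec L d, samples A V c' m = ∑ q, (Matrix.of A * V) m q * c' q.1 q.2 :=
      fun _ => rfl
    rw [e1, e3, Pi.add_apply, e4, e4, hρ]
    have : (∑ q, (Matrix.of A * V) m q * h q.1 q.2) =
      ∑ q, (Matrix.of A * V) m q * c U q.1 q.2 - ∑ q, (Matrix.of A * V) m q * chat q.1 q.2 +
      ∑ p : κ, (Matrix.of A * V) m p.1 * (chat p.1.1 p.1.2 - c U p.1.1 p.1.2) := by
        rw [← hsum]; ring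
    rw [this]
    field_simp
    ring
  change ∑ m, (ρ * (A m ᵥ* W) (Sum.inr ()) + σ⁻¹ * w m -
      (Matrix.of fun m (p : κ) => (A m ᵥ* W) (Sum.inl p)).mulVec
        (fun p => (chat p.1.1 p.1.2 - c U p.1.1 p.1.2) / σ) m) ^ 2 <
      ∑ m, (σ⁻¹ * w m) ^ 2 + 1
  simp only [key, mul_pow, ← Finset.mul_sum]
  simp only [Pi.add_apply, add_sub_cancel_left] at hres ⊢
  have : (σ⁻¹) ^ 2 * ∑ m, (samples A V (c U) m + w m - samples A V chat m) ^ 2 ≤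
    (σ⁻¹) ^ 2 * ∑ m, w m ^ 2 := by gcongr
  linarith

instance (M N : ℕ) (σ : ℝ) : IsProbabilityMeasure (jointLaw M N σ) := by
  unfold jointLaw; infer_instance

/-- Error probability of maximum likelihood decoding, for a free threshold `T`. -/
theorem errorProb_le {L d M k₀ : ℕ} {σ T : ℝ} (hk : k₀ ≤ L) (hσ : 0 < σ)
    {V : Matrix (Fin (L * d)) (Fin L × Fin d) ℝ} (hV : V.transpose * V = 1)
    {c : BlockSupport L k₀ → BlockVec L d} (hc : ∀ U, HasBlockSupport (c U) U.1)
    {ζ : (Fin M → Fin (L * d) → ℝ) → (Fin M → ℝ) → BlockSupport L k₀}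
    (hζ : IsMLDecoder σ V ζ) (hM : k₀ * d < M) (hB : 0 < bsnrMin σ c) (hT : 4 ≤ T) :
    errorProb σ V c ζ ≤ L.choose k₀ *
      (Real.sqrt (Real.exp 1 * (T / (((M : ℝ) - (k₀ * d : ℕ)) * bsnrMin σ c))) +
        (4 * (k₀ * d : ℕ) + 16) / T) := by
  classical
  set δ := Real.sqrt (Real.exp 1 * (T / (((M : ℝ) - (k₀ * d : ℕ)) * bsnrMin σ c))) +
        (4 * (k₀ * d : ℕ) + 16) / T with hδ
  have hδ0 : 0 ≤ δ := by positivity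
  have hcard : Fintype.card (BlockSupport L k₀) = L.choose k₀ := by simp
  have hpos : (0 : ℝ) < L.choose k₀ := by exact_mod_cast Nat.choose_pos hk
  have hU : ∀ U, (jointLaw M (L * d) σ).real {p | ζ p.1 (samples p.1 V (c U) + p.2) ≠ U} ≤
      L.choose k₀ * δ := fun U => by
    -- Union bound over the returned set; the term `U' = U` is empty.
    have hsub : {p : (Fin M → Fin (L * d) → ℝ) × (Fin M → ℝ) |
        ζ p.1 (samples p.1 V (c U) + p.2) ≠ U} ⊆
        ⋃ U' : BlockSupport L k₀, {p | ζ p.1 (samples p.1 V (c U) + p.2) = U' ∧ U' ≠ U} := by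
      intro p hp
      exact Set.mem_iUnion.2 ⟨_, rfl, hp⟩
    refine (measureReal_mono hsub).trans ((measureReal_iUnion_fintype_le _).trans ?_)
    rw [← hcard, ← nsmul_eq_mul]
    refine Finset.sum_le_card_nsmul _ _ _ fun U' _ => ?_
    by_cases hne : U' = U
    · simpa [hne] using hδ0
    · simp only [ne_eq, hne, not_false_eq_true, and_true]
      exact ENNReal.toReal_le_of_le_ofReal hδ0
        (measure_decode_eq_le hσ hV hc hζ hM hB hT hne)
  unfold errorProb
  calc _ ≤ ∑ _U : BlockSupport L k₀, 1 / (L.choose k₀ : ℝ) * (L.choose k₀ * δ) :=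
        Finset.sum_le_sum fun U _ => mul_le_mul_of_nonneg_left (hU U) (by positivity)
    _ = L.choose k₀ * δ := by
        rw [Finset.sum_const, Finset.card_univ, hcard, nsmul_eq_mul]; field_simp

end

/-! ### Estimates of the Gaussian tail, the Bessel function and the two sums -/

section

open MeasureTheory

/-- From `(t - x)² ≥ 0`, the integrand is at most `exp(x²/2 - x t)`. -/
theorem gaussianQ_le {x : ℝ} (hx : 0 < x) : gaussianQ x ≤ Real.exp (-x ^ 2 / 2) / x := by
  have h1 : ∫ t in Set.Ioi x, Real.exp (-t ^ 2 / 2) ≤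
      ∫ t in Set.Ioi x, Real.exp (x ^ 2 / 2) * Real.exp (-x * t) := by
    refine integral_mono_of_nonneg (Filter.Eventually.of_forall fun _ => by positivity)
      ((integrableOn_exp_mul_Ioi (by linarith) x).const_mul _)
      (Filter.Eventually.of_forall fun t => ?_)
    simp only
    rw [← Real.exp_add, Real.exp_le_exp]
    nlinarith [sq_nonneg (t - x)]
  rw [integral_const_mul, integral_exp_mul_Ioi (by linarith)] at h1
  have h2 : Real.exp (x ^ 2 / 2) * (-Real.exp (-x * x) / -x) = Real.exp (-x ^ 2 / 2) / x := by
    rw [neg_div_neg_eq, ← mul_div_assoc, ← Real.exp_add]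
    congr 2; ring
  rw [h2] at h1
  have h3 : 1 / Real.sqrt (2 * Real.pi) ≤ 1 := by
    rw [div_le_one (by positivity)]
    exact Real.one_le_sqrt.2 (by linarith [Real.pi_gt_three])
  have h4 : 0 ≤ ∫ t in Set.Ioi x, Real.exp (-t ^ 2 / 2) :=
    integral_nonneg fun _ => by positivity
  unfold gaussianQ
  calc _ ≤ 1 * ∫ t in Set.Ioi x, Real.exp (-t ^ 2 / 2) := by gcongr
    _ ≤ _ := by rwa [one_mul]

theorem one_add_sq_div_two_le_cosh {t : ℝ} (ht : 0 ≤ t) : 1 + t ^ 2 / 2 ≤ Real.cosh t := by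
  have h := Real.self_le_sinh_iff.2 (by positivity : 0 ≤ t / 2)
  have e : Real.cosh t = 1 + 2 * Real.sinh (t / 2) ^ 2 := by
    have := Real.cosh_two_mul (t / 2)
    rw [mul_div_cancel₀ t two_ne_zero, Real.cosh_sq] at this
    linarith
  rw [e]
  nlinarith [mul_self_le_mul_self (by positivity) h]

/-- With `cosh t ≥ 1 + t²/2` and `cosh(νt) ≤ exp(νt)`, completing the square leaves a Gaussian
centred at `ν/x`, integrated over the whole line. -/
theorem besselK_le {ν x : ℝ} (hν : 0 ≤ ν) (hx : 0 < x) :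
    besselK ν x ≤ Real.exp (-x) * Real.exp (ν ^ 2 / (2 * x)) * Real.sqrt (2 * Real.pi / x) := by
  have hint : Integrable fun t : ℝ =>
      Real.exp (-x) * Real.exp (ν ^ 2 / (2 * x)) * Real.exp (-(x / 2) * (t - ν / x) ^ 2) :=
    ((integrable_exp_neg_mul_sq (half_pos hx)).comp_sub_right (ν / x)).const_mul _
  have h1 : besselK ν x ≤ ∫ t in Set.Ioi (0 : ℝ),
      Real.exp (-x) * Real.exp (ν ^ 2 / (2 * x)) * Real.exp (-(x / 2) * (t - ν / x) ^ 2) := by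
    refine integral_mono_of_nonneg (Filter.Eventually.of_forall fun t => ?_) hint.integrableOn
      ((ae_restrict_mem measurableSet_Ioi).mono fun t ht => ?_)
    · have := Real.cosh_pos (ν * t)
      positivity
    simp only
    have ht0 : 0 ≤ t := le_of_lt ht
    have hc : Real.cosh (ν * t) ≤ Real.exp (ν * t) := by
      rw [Real.cosh_eq]
      have : Real.exp (-(ν * t)) ≤ Real.exp (ν * t) := by
        rw [Real.exp_le_exp]; nlinarith [mul_nonneg hν ht0]
      linarith
    refine (mul_le_mul_of_nonneg_left hc (by positivity)).trans ?_
    rw [← Real.exp_add, ← Real.exp_add, ← Real.exp_add, Real.exp_le_exp]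
    have e : -x + ν ^ 2 / (2 * x) + -(x / 2) * (t - ν / x) ^ 2 = -x * (1 + t ^ 2 / 2) + ν * t := by
      field_simp; ring
    rw [e]
    nlinarith [one_add_sq_div_two_le_cosh ht0]
  refine h1.trans ((setIntegral_le_integral hint
    (Filter.Eventually.of_forall fun _ => by simp only [Pi.zero_apply]; positivity)).trans
      (le_of_eq ?_))
  rw [integral_const_mul, integral_sub_right_eq_self (fun t => Real.exp (-(x / 2) * t ^ 2)),
    integral_gaussian]
  congr 2
  field_simp

/-- Induction in steps of two by `Γ(s + 1) = s Γ(s)`, from `Γ(1/2)` and `Γ(1)`. The index is shifted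
because `Real.Gamma 0 = 0`. -/
theorem one_le_two_pow_mul_Gamma (l : ℕ) :
    1 ≤ (2 : ℝ) ^ (l + 1) * Real.Gamma (((l + 1 : ℕ) : ℝ) / 2) := by
  induction l using Nat.twoStepInduction with
  | zero =>
    have h : 1 ≤ Real.sqrt Real.pi := Real.one_le_sqrt.2 (by linarith [Real.pi_gt_three])
    simp only [zero_add, Nat.cast_one, pow_one, Real.Gamma_one_half_eq]
    linarith
  | one => norm_num
  | more l ih _ =>
    have e : (((l + 2 + 1 : ℕ) : ℝ) / 2) = ((l + 1 : ℕ) : ℝ) / 2 + 1 := by push_cast; ring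
    rw [e, Real.Gamma_add_one (by positivity)]
    calc (1 : ℝ) ≤ 2 * (l + 1 : ℕ) * 1 := by push_cast; linarith [Nat.cast_nonneg (α := ℝ) l]
      _ ≤ 2 * (l + 1 : ℕ) * ((2 : ℝ) ^ (l + 1) * Real.Gamma (((l + 1 : ℕ) : ℝ) / 2)) := by gcongr
      _ = _ := by ring

theorem two_pow_mul_Gamma_pos {l : ℕ} (hl : 1 ≤ l) :
    0 < (2 : ℝ) ^ l * Real.Gamma ((l : ℝ) / 2) := by
  have : (0 : ℝ) < l := by exact_mod_cast hl
  have := Real.Gamma_pos_of_pos (half_pos this)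
  positivity

theorem sqrt_two_mul_sqrt_le : Real.sqrt 2 * Real.sqrt (4 * Real.pi) ≤ 6 := by
  rw [← Real.sqrt_mul (by norm_num)]
  exact Real.sqrt_le_iff.2 ⟨by norm_num, by linarith [Real.pi_lt_four]⟩

theorem Psi_le {η₀ τ : ℝ} {l : ℕ} (hl : 1 ≤ l) (hy : 1 ≤ η₀ * τ) :
    Psi η₀ l (l * τ) ≤ 6 * (Real.sqrt l * Real.sqrt (η₀ * τ) * Real.exp (-(η₀ * τ) / 2) *
      Real.exp (1 / 4)) ^ l := by
  set y := η₀ * τ with hydef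
  have hl' : (1 : ℝ) ≤ l := by exact_mod_cast hl
  have hz : η₀ * (l * τ) = l * y := by rw [hydef]; ring
  have hly : (l : ℝ) ≤ l * y := by nlinarith
  have hz1 : 1 ≤ l * y := hl'.trans hly
  have hz0 : 0 < l * y := by linarith
  have hν : 0 ≤ (l : ℝ) / 2 - 1 / 2 := by linarith
  have hK := besselK_le hν (half_pos hz0)
  have hG : Real.sqrt 2 / (2 ^ l * Real.Gamma ((l : ℝ) / 2)) ≤ Real.sqrt 2 := by
    obtain ⟨j, rfl⟩ := Nat.exists_eq_add_of_le' hl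
    exact div_le_self (by positivity) (one_le_two_pow_mul_Gamma j)
  have hG0 := two_pow_mul_Gamma_pos hl
  -- The exponent is `(l - 1)² / (4 l y)`, at most `l/4` since `y ≥ 1`.
  have hexp : Real.exp (((l : ℝ) / 2 - 1 / 2) ^ 2 / (2 * (l * y / 2))) ≤
      Real.exp (1 / 4) ^ l := by
    rw [← Real.exp_nat_mul, Real.exp_le_exp, div_le_iff₀ (by positivity)]
    nlinarith
  have hsq : Real.sqrt (2 * Real.pi / (l * y / 2)) ≤ Real.sqrt (4 * Real.pi) := by
    refine Real.sqrt_le_sqrt ?_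
    rw [div_le_iff₀ (by positivity)]
    nlinarith [Real.pi_pos]
  have hpow : (l * y) ^ ((l : ℝ) / 2 - 1 / 2) ≤ (Real.sqrt l * Real.sqrt y) ^ l := by
    calc (l * y) ^ ((l : ℝ) / 2 - 1 / 2) ≤ (l * y) ^ ((l : ℝ) / 2) :=
          Real.rpow_le_rpow_of_exponent_le hz1 (by linarith)
      _ = (Real.sqrt l * Real.sqrt y) ^ l := by
          rw [← Real.sqrt_mul (by positivity), Real.sqrt_eq_rpow, ← Real.rpow_mul_natCast hz0.le]
          congr 1; ring
  have he : Real.exp (-(l * y / 2)) = Real.exp (-y / 2) ^ l := by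
    rw [← Real.exp_nat_mul]; congr 1; ring
  unfold Psi
  rw [hz]
  calc _ ≤ Real.sqrt 2 * (Real.sqrt l * Real.sqrt y) ^ l *
        (Real.exp (-(l * y / 2)) * Real.exp (1 / 4) ^ l * Real.sqrt (4 * Real.pi)) := by
        refine mul_le_mul (mul_le_mul hG hpow (by positivity) (by positivity)) (hK.trans ?_) ?_
          (by positivity)
        · gcongr
        · refine integral_nonneg fun t => ?_
          have := Real.cosh_pos (((l : ℝ) / 2 - 1 / 2) * t)
          positivity
    _ = (Real.sqrt 2 * Real.sqrt (4 * Real.pi)) * (Real.sqrt l * Real.sqrt y *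
        Real.exp (-y / 2) * Real.exp (1 / 4)) ^ l := by rw [he]; ring
    _ ≤ _ := by
        gcongr
        exact sqrt_two_mul_sqrt_le

theorem sqrt_pow_div_factorial_le (l : ℕ) :
    Real.sqrt l ^ l / l.factorial ≤ Real.exp 1 ^ l := by
  rcases Nat.eq_zero_or_pos l with rfl | hl
  · simp
  have hl' : (1 : ℝ) ≤ l := by exact_mod_cast hl
  have h := Real.pow_div_factorial_le_exp (l : ℝ) (by positivity) l
  rw [← Real.exp_nat_mul, mul_one]
  refine le_trans ?_ h
  gcongr
  exact Real.sqrt_le_iff.2 ⟨by positivity, by nlinarith⟩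

/-- One of the two factorials is kept, to absorb the factor `√l ^ l` of `Psi_le` through
`sqrt_pow_div_factorial_le`. -/
theorem choose_mul_choose_le (a b l : ℕ) :
    (a.choose l : ℝ) * (b.choose l : ℝ) ≤ ((a : ℝ) * b) ^ l / l.factorial := by
  have h1 := Nat.choose_le_pow_div (α := ℝ) l a
  have h2 := Nat.choose_le_pow_div (α := ℝ) l b
  have hf : (1 : ℝ) ≤ l.factorial := by exact_mod_cast Nat.factorial_pos l
  calc _ ≤ ((a : ℝ) ^ l / l.factorial) * ((b : ℝ) ^ l / 1) := by
        refine mul_le_mul h1 (h2.trans ?_) (by positivity) (by positivity)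
        gcongr
    _ = _ := by rw [mul_pow]; ring

theorem sum_pow_Icc_le {q : ℝ} (h0 : 0 ≤ q) (h1 : q ≤ 1 / 2) (k : ℕ) :
    ∑ l ∈ Finset.Icc 1 k, q ^ l ≤ 2 * q := by
  have h : (1 - q) * ∑ l ∈ Finset.Icc 1 k, q ^ l = q - q ^ (k + 1) := by
    induction k with
    | zero => simp
    | succ k ih =>
      rw [Finset.sum_Icc_succ_top (by omega), mul_add, ih]
      ring
  have hp : 0 ≤ q ^ (k + 1) := by positivity
  have hs : 0 ≤ ∑ l ∈ Finset.Icc 1 k, q ^ l := Finset.sum_nonneg fun _ _ => by positivity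
  nlinarith

/-- Geometric series of ratio `q = a b exp(-x²/2)`: the sum is at most `2q/x`. Only `q ≤ 1/2` is
needed, as the decay comes from `1/x`. -/
theorem sum_choose_mul_gaussianQ_le {a b k : ℕ} {x : ℝ} (hx : 0 < x)
    (hq : (a : ℝ) * b * Real.exp (-x ^ 2 / 2) ≤ 1 / 2) :
    ∑ l ∈ Finset.Icc 1 k, (a.choose l : ℝ) * (b.choose l : ℝ) * gaussianQ (x * Real.sqrt l) ≤
      1 / x := by
  calc _ ≤ ∑ l ∈ Finset.Icc 1 k, 1 / x * ((a : ℝ) * b * Real.exp (-x ^ 2 / 2)) ^ l := by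
        refine Finset.sum_le_sum fun l hl => ?_
        have hl : 1 ≤ l := (Finset.mem_Icc.1 hl).1
        have hl' : (1 : ℝ) ≤ l := by exact_mod_cast hl
        have hs : 1 ≤ Real.sqrt l := Real.one_le_sqrt.2 hl'
        have hQ := gaussianQ_le (by positivity : 0 < x * Real.sqrt l)
        have hf : (1 : ℝ) ≤ l.factorial := by exact_mod_cast Nat.factorial_pos l
        have hQ' : gaussianQ (x * Real.sqrt l) ≤ Real.exp (-x ^ 2 / 2) ^ l / x := by
          refine hQ.trans ?_
          have e : -(x * Real.sqrt l) ^ 2 / 2 = l * (-x ^ 2 / 2) := by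
            rw [mul_pow, Real.sq_sqrt (by positivity)]; ring
          rw [e, Real.exp_nat_mul]
          gcongr
          nlinarith
        calc _ ≤ ((a : ℝ) * b) ^ l * (Real.exp (-x ^ 2 / 2) ^ l / x) := by
              refine mul_le_mul ((choose_mul_choose_le a b l).trans
                (div_le_self (by positivity) hf)) hQ' ?_ (by positivity)
              exact mul_nonneg (by positivity) (integral_nonneg fun _ => by positivity)
          _ = _ := by rw [mul_pow (_ * _)]; ring
    _ ≤ 1 / x * (2 * ((a : ℝ) * b * Real.exp (-x ^ 2 / 2))) := by
        rw [← Finset.mul_sum]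
        gcongr
        exact sum_pow_Icc_le (by positivity) hq k
    _ ≤ 1 / x * 1 := by gcongr; linarith
    _ = 1 / x := mul_one _

theorem sum_choose_mul_Psi_le {a b k : ℕ} {η₀ τ : ℝ} (hy : 1 ≤ η₀ * τ)
    (hq : (a : ℝ) * b * (Real.sqrt (η₀ * τ) * Real.exp (-(η₀ * τ) / 2)) * Real.exp (5 / 4)
      ≤ 1 / 2) :
    ∑ l ∈ Finset.Icc 1 k, (a.choose l : ℝ) * (b.choose l : ℝ) * Psi η₀ l (l * τ) ≤
      12 * ((a : ℝ) * b * (Real.sqrt (η₀ * τ) * Real.exp (-(η₀ * τ) / 2)) * Real.exp (5 / 4)) := by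
  set q := (a : ℝ) * b * (Real.sqrt (η₀ * τ) * Real.exp (-(η₀ * τ) / 2)) * Real.exp (5 / 4)
    with hqdef
  have h54 : Real.exp (5 / 4) = Real.exp 1 * Real.exp (1 / 4) := by
    rw [← Real.exp_add]; norm_num
  calc _ ≤ ∑ l ∈ Finset.Icc 1 k, 6 * q ^ l := by
        refine Finset.sum_le_sum fun l hl => ?_
        have hl : 1 ≤ l := (Finset.mem_Icc.1 hl).1
        calc _ ≤ (a.choose l : ℝ) * (b.choose l : ℝ) * (6 * (Real.sqrt l * Real.sqrt (η₀ * τ) *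
                Real.exp (-(η₀ * τ) / 2) * Real.exp (1 / 4)) ^ l) := by
              gcongr
              exact Psi_le hl hy
          _ ≤ ((a : ℝ) * b) ^ l / l.factorial * (6 * (Real.sqrt l * Real.sqrt (η₀ * τ) *
                Real.exp (-(η₀ * τ) / 2) * Real.exp (1 / 4)) ^ l) := by
              gcongr
              exact choose_mul_choose_le a b l
          _ = 6 * ((a : ℝ) * b * (Real.sqrt (η₀ * τ) * Real.exp (-(η₀ * τ) / 2)) *
                Real.exp (1 / 4)) ^ l * (Real.sqrt l ^ l / l.factorial) := by
              simp only [mul_pow]; ring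
          _ ≤ 6 * ((a : ℝ) * b * (Real.sqrt (η₀ * τ) * Real.exp (-(η₀ * τ) / 2)) *
                Real.exp (1 / 4)) ^ l * Real.exp 1 ^ l := by
              gcongr
              exact sqrt_pow_div_factorial_le l
          _ = 6 * q ^ l := by
              rw [hqdef, h54]; simp only [mul_pow]; ring
    _ ≤ 6 * (2 * q) := by
        rw [← Finset.mul_sum]
        gcongr
        exact sum_pow_Icc_le (by positivity) hq k
    _ = 12 * q := by ring

theorem errorBound_eq (η₀ : ℝ) (L k₀ d M : ℕ) {B τ : ℝ}
    (hτ : τ = ((M : ℝ) - (k₀ * d : ℕ)) * B) :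
    errorBound η₀ L k₀ d M B =
      ∑ l ∈ Finset.Icc 1 k₀, (k₀.choose l : ℝ) * ((L - k₀).choose l : ℝ) *
        gaussianQ ((1 - 2 * η₀) / 2 * Real.sqrt τ * Real.sqrt l) +
      ∑ l ∈ Finset.Icc 1 k₀, (k₀.choose l : ℝ) * ((L - k₀).choose l : ℝ) * Psi η₀ l (l * τ) := by
  unfold errorBound
  rw [← Finset.sum_add_distrib]
  refine Finset.sum_congr rfl fun l _ => ?_
  have e : ((M : ℝ) - (k₀ * d : ℕ)) * l * B = l * τ := by rw [hτ]; ring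
  have e2 : 1 / 2 * (1 - 2 * η₀) * Real.sqrt (l * τ) =
      (1 - 2 * η₀) / 2 * Real.sqrt τ * Real.sqrt l := by
    rw [Real.sqrt_mul (by positivity)]; ring
  rw [e, e2, mul_add]

theorem sqrt_mul_exp_neg_div_four_le {y : ℝ} (hy : 1 ≤ y) :
    Real.sqrt y * Real.exp (-y / 4) ≤ 32 / y := by
  -- The quadratic term of the exponential gives `y²/32 ≤ exp(y/4)`.
  have h1 := Real.quadratic_le_exp_of_nonneg (by linarith : 0 ≤ y / 4)
  have h2 : Real.sqrt y ≤ y := Real.sqrt_le_iff.2 ⟨by linarith, by nlinarith⟩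
  rw [show -y / 4 = -(y / 4) by ring, Real.exp_neg, ← div_eq_mul_inv,
    div_le_div_iff₀ (by positivity) (by linarith)]
  nlinarith

/-- The second part of the error bound vanishes when the number of pairs of a block
in the support and a block outside is at most `D exp (y / 4)`. -/
theorem sum_choose_mul_Psi_le_div {a b k : ℕ} {η₀ τ D : ℝ} (hy : 1 ≤ η₀ * τ)
    (hD : (a : ℝ) * b ≤ D * Real.exp (η₀ * τ / 4))
    (hD' : 64 * D * Real.exp (5 / 4) ≤ η₀ * τ) :
    ∑ l ∈ Finset.Icc 1 k, (a.choose l : ℝ) * (b.choose l : ℝ) * Psi η₀ l (l * τ) ≤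
      384 * D * Real.exp (5 / 4) / (η₀ * τ) := by
  set y := η₀ * τ
  have hy0 : 0 < y := by linarith
  have hD0 : 0 ≤ D := by
    by_contra! h
    have : D * Real.exp (y / 4) < 0 := mul_neg_of_neg_of_pos h (by positivity)
    have : (0 : ℝ) ≤ a * b := by positivity
    linarith
  have hq : (a : ℝ) * b * (Real.sqrt y * Real.exp (-y / 2)) * Real.exp (5 / 4) ≤
      32 * D * Real.exp (5 / 4) / y := by
    calc _ ≤ D * Real.exp (y / 4) * (Real.sqrt y * Real.exp (-y / 2)) * Real.exp (5 / 4) := by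
          gcongr
      _ = D * (Real.sqrt y * Real.exp (-y / 4)) * Real.exp (5 / 4) := by
          have : Real.exp (-y / 4) = Real.exp (y / 4) * Real.exp (-y / 2) := by
            rw [← Real.exp_add]; congr 1; ring
          rw [this]; ring
      _ ≤ D * (32 / y) * Real.exp (5 / 4) := by
          gcongr
          exact sqrt_mul_exp_neg_div_four_le hy
      _ = _ := by ring
  refine (sum_choose_mul_Psi_le hy (hq.trans ?_)).trans ?_
  · rw [div_le_iff₀ hy0]; linarith
  · calc _ ≤ 12 * (32 * D * Real.exp (5 / 4) / y) := by gcongr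
      _ = _ := by ring

/-- At `l = 1` the power of `η₀ τ` is trivial and the order of the Bessel function is zero, so the
factor `√y` of `Psi_le` is replaced by a decaying `1/√y`. -/
theorem Psi_one_le {η₀ τ : ℝ} (hy : 0 < η₀ * τ) :
    Psi η₀ 1 τ ≤ Real.exp (-(η₀ * τ) / 2) * Real.sqrt (4 * Real.pi / (η₀ * τ)) := by
  have hK := besselK_le le_rfl (half_pos hy)
  have hG : Real.sqrt 2 / (2 ^ 1 * Real.sqrt Real.pi) ≤ 1 := by
    rw [div_le_one (by positivity)]
    have : Real.sqrt 2 ≤ Real.sqrt Real.pi := Real.sqrt_le_sqrt (by linarith [Real.pi_gt_three])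
    have : 0 ≤ Real.sqrt Real.pi := by positivity
    linarith
  have hK0 : 0 ≤ besselK 0 (η₀ * τ / 2) := integral_nonneg fun t => by
    have := Real.cosh_pos (0 * t)
    positivity
  have e : 2 * Real.pi / (η₀ * τ / 2) = 4 * Real.pi / (η₀ * τ) := by field_simp; norm_num
  rw [e] at hK
  unfold Psi
  rw [Nat.cast_one, Real.Gamma_one_half_eq, sub_self, Real.rpow_zero, mul_one]
  refine (mul_le_of_le_one_left hK0 hG).trans (hK.trans (le_of_eq ?_))
  simp [neg_div]

end

/-! ### Limits in `τ` and the use of the two thresholds -/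

section

open Filter Topology

theorem tendsto_const_div_mul_sqrt {a : ℝ} (ha : 0 < a) (C : ℝ) :
    Tendsto (fun τ => C / (a * Real.sqrt τ)) atTop (𝓝 0) :=
  tendsto_const_nhds.div_atTop (Real.tendsto_sqrt_atTop.const_mul_atTop ha)

theorem tendsto_const_div_mul {a : ℝ} (ha : 0 < a) (C : ℝ) :
    Tendsto (fun τ : ℝ => C / (a * τ)) atTop (𝓝 0) :=
  tendsto_const_nhds.div_atTop (tendsto_id.const_mul_atTop ha)

theorem tendsto_sqrt_const_div_mul {a : ℝ} (ha : 0 < a) (C : ℝ) :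
    Tendsto (fun τ : ℝ => Real.sqrt (C / (a * τ))) atTop (𝓝 0) := by
  have := (Real.continuous_sqrt.tendsto 0).comp (tendsto_const_div_mul ha C)
  rwa [Real.sqrt_zero] at this

theorem log_le_of_Mbar₁_lt {η₀ B τ m : ℝ} {L k₀ : ℕ} (hη₀ : η₀ < 1 / 2) (hB : 0 < B)
    (hτ0 : 0 ≤ τ) (hτ : τ = m * B) (h : Mbar₁ η₀ L k₀ B < m) :
    2 * (Real.log ((L : ℝ) - k₀) + Real.log (Real.exp 1 / Real.sqrt 2)) ≤
      ((1 - 2 * η₀) / 2 * Real.sqrt τ) ^ 2 / 2 := by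
  have h1 : 0 < 1 - 2 * η₀ := by linarith
  rw [mul_pow, Real.sq_sqrt hτ0, hτ]
  unfold Mbar₁ at h
  rw [div_mul_eq_mul_div, div_lt_iff₀ (by positivity)] at h
  nlinarith

/-- The hypothesis gives `exp(x²/2) ≥ n² (e/√2)² ≥ 2n²` with `n = L - k₀`, while `k₀ n ≤ n²`. -/
theorem mul_exp_le_half {L k₀ : ℕ} {x : ℝ} (hk : 1 ≤ k₀) (hL : 2 * k₀ ≤ L)
    (h : 2 * (Real.log ((L : ℝ) - k₀) + Real.log (Real.exp 1 / Real.sqrt 2)) ≤ x ^ 2 / 2) :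
    (k₀ : ℝ) * (L - k₀ : ℕ) * Real.exp (-x ^ 2 / 2) ≤ 1 / 2 := by
  rw [Nat.cast_sub (by omega)]
  set n : ℝ := (L : ℝ) - k₀ with hn
  have hL' : (2 : ℝ) * k₀ ≤ L := by exact_mod_cast hL
  have hk' : (1 : ℝ) ≤ k₀ := by exact_mod_cast hk
  have hkn : (k₀ : ℝ) ≤ n := by linarith
  have hn0 : 0 < n := by linarith
  have he : Real.exp (-x ^ 2 / 2) ≤ 1 / (n ^ 2 * 2) := by
    have h2 : (2 : ℝ) ≤ (Real.exp 1 / Real.sqrt 2) ^ 2 := by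
      rw [div_pow, Real.sq_sqrt (by norm_num)]
      nlinarith [Real.add_one_le_exp 1]
    have e1 : Real.exp (2 * (Real.log n + Real.log (Real.exp 1 / Real.sqrt 2))) =
        n ^ 2 * (Real.exp 1 / Real.sqrt 2) ^ 2 := by
      rw [← Real.log_mul (by positivity) (by positivity), ← mul_pow, two_mul, Real.exp_add,
        Real.exp_log (by positivity), sq]
    rw [neg_div, Real.exp_neg, ← one_div]
    refine one_div_le_one_div_of_le (by positivity) ?_
    calc n ^ 2 * 2 ≤ n ^ 2 * (Real.exp 1 / Real.sqrt 2) ^ 2 := by gcongr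
      _ ≤ _ := by rw [← e1]; exact Real.exp_le_exp.2 h
  calc (k₀ : ℝ) * n * Real.exp (-x ^ 2 / 2) ≤ n * n * (1 / (n ^ 2 * 2)) := by gcongr
    _ = 1 / 2 := by field_simp

/-- The argument of the logarithm is `e²/√2`; the constant can therefore be dropped from `Mbar₂`. -/
theorem log_const_nonneg :
    0 ≤ 1 / 2 * Real.log (2 * b₀ * Real.exp 1 ^ 2 / Real.sqrt Real.pi) := by
  refine mul_nonneg (by norm_num) (Real.log_nonneg ?_)
  unfold b₀
  rw [one_le_div (by positivity), Real.sqrt_mul (by norm_num)]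
  have h2 : 1 ≤ Real.sqrt 2 := Real.one_le_sqrt.2 (by norm_num)
  have he : 2 ≤ Real.exp 1 ^ 2 := by nlinarith [Real.add_one_le_exp 1]
  have hp : 0 ≤ Real.sqrt Real.pi := Real.sqrt_nonneg _
  have h3 : 2 ≤ Real.sqrt 2 * Real.exp 1 ^ 2 := by nlinarith
  nlinarith [mul_le_mul_of_nonneg_right h3 hp]

theorem mul_log_le_of_Mbar₂_lt {η₀ r₀ B τ m : ℝ} {L k₀ : ℕ} (hη₀ : 0 < η₀) (hr₀ : 0 < r₀)
    (hB : 0 < B) (hk : 1 ≤ k₀) (hr : 2 ≤ k₀ ∨ 1 ≤ r₀) (hτ : τ = m * B)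
    (h : Mbar₂ η₀ r₀ L k₀ B < m) :
    4 * ((k₀ : ℝ) / 2 + r₀ - 1) * Real.log ((L : ℝ) - k₀) ≤ r₀ * (η₀ * τ) := by
  have hc := log_const_nonneg
  have hf : 0 ≤ 4 * ((k₀ : ℝ) / 2 + r₀ - 1) := by
    rcases hr with hr | hr
    · have : (2 : ℝ) ≤ k₀ := by exact_mod_cast hr
      linarith
    · have : (1 : ℝ) ≤ k₀ := by exact_mod_cast hk
      linarith
  unfold Mbar₂ at h
  rw [div_mul_eq_mul_div, div_lt_iff₀ (by positivity)] at h
  rw [hτ]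
  have := mul_nonneg hf hc
  nlinarith

/-- If `k₀ ≤ 2r₀ + 2`, then `k₀/2 + r₀ - 1 ≥ r₀` yields `n ≤ exp(y/4)` and `k₀` is bounded.
Otherwise that factor exceeds `2r₀`, so `n² ≤ exp(y/4)`, and `k₀ n ≤ n²`. -/
theorem mul_le_mul_exp_of_two_le {L k₀ : ℕ} {r₀ y : ℝ} (hr₀ : 0 < r₀) (hk : 2 ≤ k₀)
    (hL : 2 * k₀ ≤ L)
    (h : 4 * ((k₀ : ℝ) / 2 + r₀ - 1) * Real.log ((L : ℝ) - k₀) ≤ r₀ * y) :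
    (k₀ : ℝ) * (L - k₀ : ℕ) ≤ (2 * r₀ + 2) * Real.exp (y / 4) := by
  rw [Nat.cast_sub (by omega)]
  set n : ℝ := (L : ℝ) - k₀ with hn
  have hL' : (2 : ℝ) * k₀ ≤ L := by exact_mod_cast hL
  have hk' : (2 : ℝ) ≤ k₀ := by exact_mod_cast hk
  have hkn : (k₀ : ℝ) ≤ n := by linarith
  have hn0 : 0 < n := by linarith
  have hlog : 0 ≤ Real.log n := Real.log_nonneg (by linarith)
  by_cases hkr : (k₀ : ℝ) ≤ 2 * r₀ + 2
  · have h4 : Real.log n ≤ y / 4 := by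
      have : r₀ * (4 * Real.log n) ≤ r₀ * y := by nlinarith
      linarith [le_of_mul_le_mul_left this hr₀]
    have : n ≤ Real.exp (y / 4) := (Real.log_le_iff_le_exp hn0).1 h4
    gcongr
  · push Not at hkr
    have h8 : Real.log n + Real.log n ≤ y / 4 := by
      have : r₀ * (8 * Real.log n) ≤ r₀ * y := by nlinarith
      linarith [le_of_mul_le_mul_left this hr₀]
    rw [← Real.log_mul hn0.ne' hn0.ne'] at h8
    have h9 := (Real.log_le_iff_le_exp (by positivity)).1 h8
    have : 0 < Real.exp (y / 4) := by positivity
    nlinarith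

/-- The error bound is small for a large product `τ` of the number of excess samples and the
minimum block SNR, as soon as the number of neighbouring supports is under control. -/
theorem errorBound_le {η₀ τ B D : ℝ} {L k₀ d M : ℕ} (hη₀' : η₀ < 1 / 2) (hτ0 : 0 < τ)
    (hτ : τ = ((M : ℝ) - (k₀ * d : ℕ)) * B)
    (hq : (k₀ : ℝ) * (L - k₀ : ℕ) * Real.exp (-((1 - 2 * η₀) / 2 * Real.sqrt τ) ^ 2 / 2) ≤ 1 / 2)
    (hy : 1 ≤ η₀ * τ) (hD : (k₀ : ℝ) * (L - k₀ : ℕ) ≤ D * Real.exp (η₀ * τ / 4))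
    (hD' : 64 * D * Real.exp (5 / 4) ≤ η₀ * τ) :
    errorBound η₀ L k₀ d M B ≤ 1 / ((1 - 2 * η₀) / 2 * Real.sqrt τ) +
      384 * D * Real.exp (5 / 4) / (η₀ * τ) := by
  have h1 : 0 < 1 - 2 * η₀ := by linarith
  rw [errorBound_eq η₀ L k₀ d M hτ]
  exact add_le_add (sum_choose_mul_gaussianQ_le (by positivity) hq)
    (sum_choose_mul_Psi_le_div hy hD hD')

theorem eventually_errorBound_lt {η₀ : ℝ} (hη₀ : 0 < η₀) (hη₀' : η₀ < 1 / 2) (L k₀ : ℕ)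
    {ε : ℝ} (hε : 0 < ε) :
    ∀ᶠ τ : ℝ in atTop, ∀ (d M : ℕ) (B : ℝ), τ = ((M : ℝ) - (k₀ * d : ℕ)) * B →
      errorBound η₀ L k₀ d M B < ε := by
  have h1 : 0 < (1 - 2 * η₀) / 2 := by linarith
  set D : ℝ := (k₀ : ℝ) * (L - k₀ : ℕ) with hDdef
  have hD0 : 0 ≤ D := by positivity
  have hx : Tendsto (fun τ => D * Real.exp (-((1 - 2 * η₀) / 2 * Real.sqrt τ) ^ 2 / 2)) atTop
      (𝓝 (D * 0)) := by
    refine Tendsto.const_mul _ (Real.tendsto_exp_atBot.comp ?_)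
    have : Tendsto (fun τ => ((1 - 2 * η₀) / 2 * Real.sqrt τ) ^ 2 / 2) atTop atTop :=
      ((tendsto_pow_atTop two_ne_zero).comp
        (Real.tendsto_sqrt_atTop.const_mul_atTop h1)).atTop_div_const two_pos
    simp only [neg_div]
    exact tendsto_neg_atTop_atBot.comp this
  rw [mul_zero] at hx
  have hητ : Tendsto (fun τ : ℝ => η₀ * τ) atTop atTop := tendsto_id.const_mul_atTop hη₀
  filter_upwards [hx.eventually_lt_const (by norm_num : (0 : ℝ) < 1 / 2),
    (tendsto_const_div_mul_sqrt h1 1).eventually_lt_const (half_pos hε),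
    (tendsto_const_div_mul hη₀ (384 * D * Real.exp (5 / 4))).eventually_lt_const (half_pos hε),
    hητ.eventually_ge_atTop 1, hητ.eventually_ge_atTop (64 * D * Real.exp (5 / 4)),
    eventually_gt_atTop 0] with τ hq ha hb hy hy' hτ0 d M B hτ
  -- With `L` and `k₀` fixed, the constant `D = k₀ (L - k₀)` itself suffices.
  have hD : (k₀ : ℝ) * (L - k₀ : ℕ) ≤ D * Real.exp (η₀ * τ / 4) :=
    le_mul_of_one_le_right hD0 (Real.one_le_exp (by linarith))
  have := errorBound_le (B := B) (d := d) (M := M) hη₀' hτ0 hτ hq.le hy hD hy'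
  linarith

theorem eventually_errorProb_lt {L k₀ d : ℕ} (hk : k₀ ≤ L) {ε : ℝ} (hε : 0 < ε) :
    ∀ᶠ τ : ℝ in atTop, ∀ (M : ℕ) (σ : ℝ) (V : Matrix (Fin (L * d)) (Fin L × Fin d) ℝ)
      (c : BlockSupport L k₀ → BlockVec L d)
      (ζ : (Fin M → Fin (L * d) → ℝ) → (Fin M → ℝ) → BlockSupport L k₀),
      0 < σ → V.transpose * V = 1 → (∀ U, HasBlockSupport (c U) U.1) → IsMLDecoder σ V ζ →
      k₀ * d < M → 0 < bsnrMin σ c → τ = ((M : ℝ) - (k₀ * d : ℕ)) * bsnrMin σ c →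
      errorProb σ V c ζ < ε := by
  have hC : (0 : ℝ) < L.choose k₀ := by exact_mod_cast Nat.choose_pos hk
  -- `T` depends only on `L`, `k₀`, `d` and `ε`, so `√(eT/τ)` still tends to zero.
  obtain ⟨T, hT4, hT⟩ : ∃ T : ℝ, 4 ≤ T ∧
      (4 * (k₀ * d : ℕ) + 16) / T < ε / (2 * L.choose k₀) := by
    have h := (tendsto_const_div_mul one_pos (4 * ((k₀ * d : ℕ) : ℝ) + 16)).eventually_lt_const
      (by positivity : 0 < ε / (2 * L.choose k₀))
    obtain ⟨T, h1, h2⟩ := (h.and (eventually_ge_atTop 4)).exists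
    exact ⟨T, h2, by simpa using h1⟩
  filter_upwards [(tendsto_sqrt_const_div_mul one_pos (Real.exp 1 * T)).eventually_lt_const
    (by positivity : 0 < ε / (2 * L.choose k₀))] with τ h M σ V c ζ hσ hV hc hζ hM hB hτ
  have hle := errorProb_le hk hσ hV hc hζ hM hB hT4
  rw [← hτ] at hle
  rw [one_mul, mul_div_assoc] at h
  calc _ ≤ _ := hle
    _ < L.choose k₀ * (ε / (2 * L.choose k₀) + ε / (2 * L.choose k₀)) := by gcongr
    _ = ε := by field_simp; norm_num

theorem eventually_errorBound_lt_uniform {η₀ r₀ : ℝ} (hη₀ : 0 < η₀) (hη₀' : η₀ < 1 / 2)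
    (hr₀ : 0 < r₀) {ε : ℝ} (hε : 0 < ε) :
    ∀ᶠ τ : ℝ in atTop, ∀ (L k₀ d M : ℕ) (B : ℝ), 1 ≤ k₀ → 2 * k₀ ≤ L → (2 ≤ k₀ ∨ 1 ≤ r₀) →
      0 < B → τ = ((M : ℝ) - (k₀ * d : ℕ)) * B →
      (M : ℝ) > (k₀ * d : ℕ) + max (Mbar₁ η₀ L k₀ B) (Mbar₂ η₀ r₀ L k₀ B) →
      errorBound η₀ L k₀ d M B < ε := by
  have h1 : 0 < (1 - 2 * η₀) / 2 := by linarith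
  set D : ℝ := 2 * r₀ + 2 with hDdef
  have hητ : Tendsto (fun τ : ℝ => η₀ * τ) atTop atTop := tendsto_id.const_mul_atTop hη₀
  filter_upwards [(tendsto_const_div_mul_sqrt h1 1).eventually_lt_const (half_pos hε),
    (tendsto_const_div_mul hη₀ (384 * D * Real.exp (5 / 4))).eventually_lt_const (half_pos hε),
    (tendsto_sqrt_const_div_mul hη₀ (4 * Real.pi)).eventually_lt_const (half_pos hε),
    hητ.eventually_ge_atTop 1, hητ.eventually_ge_atTop (64 * D * Real.exp (5 / 4)),
    eventually_gt_atTop 0] with τ ha hb hb' hy hy' hτ0 L k₀ d M B hk hL hr hB hτ hM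
  obtain ⟨hM₁, hM₂⟩ := max_lt_iff.1 (lt_sub_iff_add_lt'.2 hM)
  have hq := mul_exp_le_half hk hL
    (log_le_of_Mbar₁_lt hη₀' hB hτ0.le hτ hM₁)
  have hlog := mul_log_le_of_Mbar₂_lt hη₀ hr₀ hB hk hr hτ hM₂
  by_cases hk2 : 2 ≤ k₀
  · have := errorBound_le hη₀' hτ0 hτ hq hy (mul_le_mul_exp_of_two_le hr₀ hk2 hL hlog) hy'
    linarith
  -- Here `k₀/2 + r₀ - 1 = r₀ - 1/2 ≥ r₀/2`, which gives only `n ≤ exp(y/2)`. This exactly cancels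
  -- the exponential in `Psi_one_le`.
  obtain rfl : k₀ = 1 := by omega
  have hr1 : 1 ≤ r₀ := hr.resolve_left hk2
  have hQ := sum_choose_mul_gaussianQ_le (k := 1) (by positivity) hq
  rw [errorBound_eq η₀ L 1 d M hτ]
  refine lt_of_le_of_lt (add_le_add_left hQ _) ?_
  have hPsi := Psi_one_le (by linarith : 0 < η₀ * τ)
  have hL' : (2 : ℝ) ≤ L := by exact_mod_cast hL
  have hn : ((L - 1 : ℕ) : ℝ) ≤ Real.exp (η₀ * τ / 2) := by
    rw [Nat.cast_sub (by omega)]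
    simp only [Nat.cast_one] at hlog ⊢
    refine (Real.log_le_iff_le_exp (by linarith)).1 ?_
    have h0 : 0 ≤ Real.log ((L : ℝ) - 1) := Real.log_nonneg (by linarith)
    have : r₀ * (2 * Real.log ((L : ℝ) - 1)) ≤ r₀ * (η₀ * τ) := by nlinarith
    linarith [le_of_mul_le_mul_left this hr₀]
  have hP : ((L - 1 : ℕ) : ℝ) * Psi η₀ 1 τ ≤ Real.sqrt (4 * Real.pi / (η₀ * τ)) := by
    calc _ ≤ ((L - 1 : ℕ) : ℝ) *
          (Real.exp (-(η₀ * τ) / 2) * Real.sqrt (4 * Real.pi / (η₀ * τ))) := by gcongr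
      _ ≤ Real.exp (η₀ * τ / 2) *
          (Real.exp (-(η₀ * τ) / 2) * Real.sqrt (4 * Real.pi / (η₀ * τ))) := by gcongr
      _ = _ := by
          rw [← mul_assoc, ← Real.exp_add, neg_div, add_neg_cancel, Real.exp_zero, one_mul]
  simp only [Finset.Icc_self, Finset.sum_singleton, Nat.choose_self, Nat.choose_one_right,
    Nat.cast_one, one_mul]
  linarith

end

end BlockRecovery

open BlockRecovery
theorem lemma3 (η₀ r₀ : ℝ) (hη₀ : 0 < η₀) (hη₀' : η₀ < 1 / 2) (hr₀ : 0 < r₀) :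
    -- For a given block model, the probability of error of ML decoding, and its explicit upper
    -- bound, vanish.
    (∀ (L k₀ d : ℕ), 1 ≤ k₀ → k₀ < L → 1 ≤ d → ∀ ε : ℝ, 0 < ε → ∃ R : ℝ,
      ∀ (M : ℕ) (σ : ℝ) (V : Matrix (Fin (L * d)) (Fin L × Fin d) ℝ)
        (c : BlockSupport L k₀ → BlockVec L d)
        (ζ : (Fin M → Fin (L * d) → ℝ) → (Fin M → ℝ) → BlockSupport L k₀),
        0 < σ → V.transpose * V = 1 → (∀ U, HasBlockSupport (c U) U.1) → IsMLDecoder σ V ζ →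
        R ≤ ((M : ℝ) - (k₀ * d : ℕ)) * bsnrMin σ c →
        (M : ℝ) > (k₀ * d : ℕ) +
          max (Mbar₁ η₀ L k₀ (bsnrMin σ c)) (Mbar₂ η₀ r₀ L k₀ (bsnrMin σ c)) →
        errorProb σ V c ζ < ε ∧ errorBound η₀ L k₀ d M (bsnrMin σ c) < ε) ∧
    -- The explicit upper bound vanishes even uniformly in the block model.
    (∀ ε : ℝ, 0 < ε → ∃ R : ℝ,
      ∀ (L k₀ d M : ℕ) (B : ℝ), 1 ≤ k₀ → 2 * k₀ ≤ L → 1 ≤ d → (2 ≤ k₀ ∨ 1 ≤ r₀) → 0 < B →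
        R ≤ ((M : ℝ) - (k₀ * d : ℕ)) * B →
        (M : ℝ) > (k₀ * d : ℕ) + max (Mbar₁ η₀ L k₀ B) (Mbar₂ η₀ r₀ L k₀ B) →
        errorBound η₀ L k₀ d M B < ε) := by
  constructor
  · intro L k₀ d _ hkL _ ε hε
    obtain ⟨R, hR⟩ := Filter.eventually_atTop.1
      ((eventually_errorProb_lt (d := d) hkL.le hε).and
        ((eventually_errorBound_lt hη₀ hη₀' L k₀ hε).and (Filter.eventually_gt_atTop 0)))
    refine ⟨R, fun M σ V c ζ hσ hV hc hζ hRτ _ => ?_⟩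
    obtain ⟨hP, hE, hτ0⟩ := hR _ hRτ
    -- With this, positivity of the product `τ` forces both `M > k` and a positive minimum block
    -- SNR.
    have hB0 : 0 ≤ bsnrMin σ c :=
      Real.iInf_nonneg fun _ => Real.iInf_nonneg fun _ => by positivity
    have hMB := (pos_iff_pos_of_mul_pos hτ0)
    have hB : 0 < bsnrMin σ c := lt_of_le_of_ne hB0 fun h => by simp [← h] at hτ0
    have hM : k₀ * d < M := by exact_mod_cast sub_pos.1 (hMB.2 hB)
    exact ⟨hP M σ V c ζ hσ hV hc hζ hM hB rfl, hE d M _ rfl⟩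
  · intro ε hε
    obtain ⟨R, hR⟩ := Filter.eventually_atTop.1
      (eventually_errorBound_lt_uniform hη₀ hη₀' hr₀ hε)
    exact ⟨R, fun L k₀ d M B hk hL _ hr hB hRτ hM => hR _ hRτ L k₀ d M B hk hL hr hB rfl hM⟩
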